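/- **Setting.** Let $W$ be a finite connected graph (loops and multiple edges allowed) with at least two vertices, vertex set $V$ and edge set $E$; for instance the white subgraph $\mathcal G_W$ of a finite connected bipartite quad-graph $\mathcal G$ embedded in an oriented surface. Let $\theta=(\theta_e)_{e\in E}$ be any real labeling of the edges (not necessarily induced by a labeling of $E(\mathcal G)$) and let $(\Theta_x)_{x\in V}$ be any real numbers. For an even real function $J(\cdot;\theta)$ consider, for real variables $X=(X_x)_{x\in V}\in\mathbb R^V$, the action functional $$S(X)=\sum_{e=(x,y)\in E}\bigl(J(X_x+X_y;\theta_e)+J(X_x-X_y;\theta_e)\bigr)+\sum_{x\in V}\Theta_xX_x .$$ The Dirichlet boundary value problem for $S$ asks, given any subset $B\subseteq V$ and any prescribed real values $b_x$, $x\in B$, for an extremum of $S$ under the constraint $X_x=b_x$ for all $x\in B$. Below, $\log q(u)$ denotes the continuous branch along the real line with $\log q(0)=0$, for a function $q$ that is holomorphic and zero-free near $\mathbb R$ with $q(0)=1$. * *Rectangular (Q4).* Let $\tau$ be purely imaginary with $\operatorname{Im}\tau>0$, let $h^k=e^{i\pi\tau k}$, $$\vartheta_1(v)=2\sum_{n\ge0}(-1)^nh^{(n+1/2)^2}\sin((2n+1)v),\qquad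 \vartheta_4(v)=1+2\sum_{n\ge1}(-1)^nh^{n^2}\cos(2nv),$$ $$J(Z;\theta)=\sum_{j\in\{1,4\}} i\int_0^Z\log\left((-1)^j\frac{\vartheta_j\left(\frac{u+i\theta}{2i}\right)}{\vartheta_j\left(\frac{u-i\theta}{2i}\right)}\right)du .$$ The convexity condition is: $e^{i\theta_e}\in S^1_+$ for all $e$, or $e^{i\theta_e}\in S^1_-$ for all $e$, where $S^1_\pm=\{z\in\mathbb C:|z|=1,\ \pm\operatorname{Im}z>0\}$. * *Rhombic (Q4).* Let $\omega,\omega'$ be half-periods whose ratio $\tau=\omega'/\omega$ is non-real with $|\tau|=1$ and such that $2\omega+2\omega'\in\mathbb R^+$. Let $\Gamma=2\omega\mathbb Z+2\omega'\mathbb Z$, let $\sigma$ be the Weierstrass $\sigma$-function of $\Gamma$, $\zeta=\sigma'/\sigma$, and $$J(Z;\theta)=i\int_0^Z\log\left(-\frac{\sigma(u+i\theta)}{\sigma(u-i\theta)}\right)du .$$ The convexity condition is: $Z+i\theta_e\notin\Gamma$ for all $e\in E$ and $Z\in\mathbb R$, and the number $\operatorname{Im}\bigl(\zeta(Z+i\theta_e)-\zeta(Z-i\theta_e)\bigr)$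 is non-zero and has the same sign for all $e\in E$ and all $Z\in\mathbb R$. (It holds in particular if all $\theta_e$ lie in $(0,r)$, or all lie in $(-r,0)$, where $r>0$ is such that $\operatorname{Im}(\zeta(Z+i\theta)-\zeta(Z-i\theta))$ has no zero and $Z+i\theta\notin\Gamma$ for $0<\theta<r$, $Z\in\mathbb R$.) **Theorem.** In both cases, if the labels satisfy the convexity condition, then the Dirichlet boundary value problem for (Q4) is uniquely solvable: for every choice of $\Theta$, $B$ and $b$, the functional $S$ is real-valued, it attains an extremum on $\{X\in\mathbb R^V: X_x=b_x\ \forall x\in B\}$, and this is the only extremum, even among local extrema, of $S$ on that set. -/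

import Mathlib

open Complex Topology

noncomputable section

namespace QuadFour

/-! ### Jacobi theta functions -/

/-- The Jacobi theta function
`ϑ₁(v) = 2 (h^(1/4) sin v - h^(9/4) sin 3v + h^(25/4) sin 5v ∓ …)`, where `h^k = exp(i π τ k)`. -/
def theta1 (τ v : ℂ) : ℂ :=
  2 * ∑' n : ℕ, (-1) ^ n * cexp (I * Real.pi * τ * ((n : ℂ) + 1 / 2) ^ 2) *
    Complex.sin ((2 * (n : ℂ) + 1) * v)

/-- The Jacobi theta function
`ϑ₄(v) = 1 - 2 (h cos 2v - h^4 cos 4v + h^9 cos 6v ∓ …)`, where `h^k = exp(i π τ k)`. -/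
def theta4 (τ v : ℂ) : ℂ :=
  1 - 2 * ∑' n : ℕ, (-1) ^ n * cexp (I * Real.pi * τ * ((n : ℂ) + 1) ^ 2) *
    Complex.cos (2 * ((n : ℂ) + 1) * v)

/-- `ϑ₁` in terms of Mathlib's two-variable theta function. -/
theorem theta1_eq {τ : ℂ} (hτ : 0 < τ.im) (v : ℂ) :
    theta1 τ v = -I * cexp (I * Real.pi * τ / 4 + I * v) *
      jacobiTheta₂ (v / Real.pi + 1 / 2 + τ / 2) τ := by
  have hpi : (Real.pi : ℂ) ≠ 0 := by exact_mod_cast Real.pi_ne_zero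
  have key := ((hasSum_jacobiTheta₂_term (v / Real.pi + 1 / 2 + τ / 2) hτ).nat_add_neg_add_one).mul_left
    (-I * cexp (I * Real.pi * τ / 4 + I * v))
  rw [← key.tsum_eq, theta1, ← tsum_mul_left]
  congr 1
  funext n
  have e1 : cexp (I * Real.pi * τ / 4 + I * v) *
      jacobiTheta₂_term (n : ℤ) (v / Real.pi + 1 / 2 + τ / 2) τ =
      (-1) ^ n * cexp (I * Real.pi * τ * ((n : ℂ) + 1 / 2) ^ 2) *
        cexp ((2 * (n : ℂ) + 1) * v * I) := by
    rw [jacobiTheta₂_term, ← Complex.exp_pi_mul_I, ← Complex.exp_nat_mul, ← Complex.exp_add,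
      ← Complex.exp_add, ← Complex.exp_add]
    congr 1
    push_cast
    field_simp
    ring
  have e2 : cexp (I * Real.pi * τ / 4 + I * v) *
      jacobiTheta₂_term (-((n : ℤ) + 1)) (v / Real.pi + 1 / 2 + τ / 2) τ =
      -((-1) ^ n * cexp (I * Real.pi * τ * ((n : ℂ) + 1 / 2) ^ 2) *
        cexp (-((2 * (n : ℂ) + 1) * v) * I)) := by
    have hs : -((-1 : ℂ) ^ n) = cexp (-(((n : ℂ) + 1) * (Real.pi * I))) := by
      rw [Complex.exp_neg, show ((n : ℂ) + 1) * (Real.pi * I) = ((n + 1 : ℕ) : ℂ) * (Real.pi * I) by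
        push_cast; ring, Complex.exp_nat_mul, Complex.exp_pi_mul_I, ← inv_pow]
      norm_num [pow_succ]
    rw [neg_mul_eq_neg_mul, neg_mul_eq_neg_mul, hs, jacobiTheta₂_term, ← Complex.exp_add,
      ← Complex.exp_add, ← Complex.exp_add]
    congr 1
    push_cast
    field_simp
    ring
  rw [mul_assoc (-I), mul_add, e1, e2, Complex.sin]
  ring

/-- `ϑ₄` in terms of Mathlib's two-variable theta function. -/
theorem theta4_eq {τ : ℂ} (hτ : 0 < τ.im) (v : ℂ) :
    theta4 τ v = jacobiTheta₂ (v / Real.pi + 1 / 2) τ := by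
  have hpi : (Real.pi : ℂ) ≠ 0 := by exact_mod_cast Real.pi_ne_zero
  have key := (hasSum_jacobiTheta₂_term (v / Real.pi + 1 / 2) hτ).nat_add_neg
  have key2 := (hasSum_nat_add_iff' 1).mpr key
  have h0 : jacobiTheta₂_term 0 (v / Real.pi + 1 / 2) τ = 1 := by simp [jacobiTheta₂_term]
  simp only [Finset.sum_range_one, Nat.cast_zero, neg_zero, h0] at key2
  have : ∀ n : ℕ, jacobiTheta₂_term ((n + 1 : ℕ) : ℤ) (v / Real.pi + 1 / 2) τ +
      jacobiTheta₂_term (-((n + 1 : ℕ) : ℤ)) (v / Real.pi + 1 / 2) τ =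
      -2 * ((-1) ^ n * cexp (I * Real.pi * τ * ((n : ℂ) + 1) ^ 2) *
        Complex.cos (2 * ((n : ℂ) + 1) * v)) := by
    intro n
    have hs : -((-1 : ℂ) ^ n) = cexp (((n : ℂ) + 1) * (Real.pi * I)) := by
      rw [show ((n : ℂ) + 1) * (Real.pi * I) = ((n + 1 : ℕ) : ℂ) * (Real.pi * I) by
        push_cast; ring, Complex.exp_nat_mul, Complex.exp_pi_mul_I]
      norm_num [pow_succ]
    have hs' : -((-1 : ℂ) ^ n) = cexp (-(((n : ℂ) + 1) * (Real.pi * I))) := by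
      rw [Complex.exp_neg, ← hs, ← neg_inv, ← inv_pow]
      norm_num
    have e1 : jacobiTheta₂_term ((n + 1 : ℕ) : ℤ) (v / Real.pi + 1 / 2) τ =
        -((-1) ^ n) * cexp (I * Real.pi * τ * ((n : ℂ) + 1) ^ 2) *
          cexp (2 * ((n : ℂ) + 1) * v * I) := by
      rw [hs, jacobiTheta₂_term, ← Complex.exp_add, ← Complex.exp_add]
      congr 1
      push_cast
      field_simp
      ring
    have e2 : jacobiTheta₂_term (-((n + 1 : ℕ) : ℤ)) (v / Real.pi + 1 / 2) τ =
        -((-1) ^ n) * cexp (I * Real.pi * τ * ((n : ℂ) + 1) ^ 2) *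
          cexp (-(2 * ((n : ℂ) + 1) * v) * I) := by
      rw [hs', jacobiTheta₂_term, ← Complex.exp_add, ← Complex.exp_add]
      congr 1
      push_cast
      field_simp
      ring
    rw [e1, e2, Complex.cos]
    ring
  simp only [this] at key2
  rw [theta4, sub_eq_add_neg, neg_mul_eq_neg_mul, ← tsum_mul_left, key2.tsum_eq]
  ring

/-! ### The Weierstrass functions -/

/-- The Weierstrass `σ`-function of a lattice,
`σ(u) = u ∏_{w ≠ 0} (1 - u/w) exp(u/w + u²/(2w²))`. -/
def weierstrassSigma (L : PeriodPair) (u : ℂ) : ℂ :=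
  u * ∏' w : {w : L.lattice // w ≠ 0},
    (1 - u / (w : ℂ)) * cexp (u / (w : ℂ) + u ^ 2 / (2 * (w : ℂ) ^ 2))

/-- The Weierstrass `ζ`-function of a lattice, `ζ = σ'/σ`. -/
def weierstrassZeta (L : PeriodPair) (u : ℂ) : ℂ :=
  deriv (weierstrassSigma L) u / weierstrassSigma L u

/-- The lattice `ℤ 2ω + ℤ 2ω'` (with `L.ω₁ = 2ω`, `L.ω₂ = 2ω'`) has a half-period ratio
`τ = ω'/ω` of modulus `1` (`τ` is non-real by definition of `PeriodPair`), and
`Ω = 2ω + 2ω'` is a positive real number. -/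
structure IsRhombic (L : PeriodPair) : Prop where
  norm_ratio : ‖L.ω₂ / L.ω₁‖ = 1
  sum_im : (L.ω₁ + L.ω₂).im = 0
  sum_re : 0 < (L.ω₁ + L.ω₂).re

/-! ### Action functionals -/

/-- The logarithm of a function `q`, holomorphic and without zeros near the real line and with
`q 0 = 1`, on the real line: the continuous branch of `log (q Z)` that vanishes at `Z = 0`. -/
def logBranch (q : ℂ → ℂ) (Z : ℝ) : ℂ :=
  ∫ u in (0 : ℝ)..Z, deriv q u / q u

theorem hasDerivAt_logBranch {q : ℂ → ℂ} (ha : ∀ x : ℝ, AnalyticAt ℂ q x)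
    (hne : ∀ x : ℝ, q x ≠ 0) (Z : ℝ) : HasDerivAt (logBranch q) (deriv q Z / q Z) Z := by
  have hc : Continuous fun u : ℝ => deriv q u / q u := by
    rw [continuous_iff_continuousAt]
    intro x
    have h1 : ContinuousAt (deriv q) (x : ℂ) := (ha x).deriv.continuousAt
    have h2 : ContinuousAt q (x : ℂ) := (ha x).continuousAt
    have hx : ContinuousAt (fun u : ℝ => (u : ℂ)) x := Complex.continuous_ofReal.continuousAt
    exact (ContinuousAt.comp (f := fun u : ℝ => (u : ℂ)) h1 hx).div
      (ContinuousAt.comp (f := fun u : ℝ => (u : ℂ)) h2 hx) (hne x)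
  exact intervalIntegral.integral_hasDerivAt_right (hc.intervalIntegrable _ _)
    (hc.stronglyMeasurableAtFilter _ _) hc.continuousAt

theorem exp_logBranch {q : ℂ → ℂ} (ha : ∀ x : ℝ, AnalyticAt ℂ q x) (hne : ∀ x : ℝ, q x ≠ 0)
    (h0 : q 0 = 1) (Z : ℝ) : cexp (logBranch q Z) = q Z := by
  have hd : ∀ x : ℝ, HasDerivAt (fun x : ℝ => cexp (-logBranch q x) * q x) 0 x := by
    intro x
    have h1 := ((hasDerivAt_logBranch ha hne x).neg).cexp
    have h2 : HasDerivAt (fun x : ℝ => q x) (deriv q x) x :=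
      (ha x).differentiableAt.hasDerivAt.comp_ofReal
    convert! h1.mul h2 using 1
    have := hne x
    simp only [Pi.neg_apply]
    field_simp
    ring
  have hconst := is_const_of_deriv_eq_zero (fun x => (hd x).differentiableAt)
    (fun x => (hd x).deriv) Z 0
  simp only [logBranch, intervalIntegral.integral_same, neg_zero, Complex.exp_zero, one_mul,
    Complex.ofReal_zero, h0] at hconst
  have hz : cexp (-logBranch q Z) * q Z = 1 := hconst
  rw [Complex.exp_neg] at hz
  field_simp at hz
  exact hz.symm

/-- `i ∫₀^Z log q(u) du`, with the branch of the logarithm above. -/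
def logIntegral (q : ℂ → ℂ) (Z : ℝ) : ℂ :=
  I * ∫ u in (0 : ℝ)..Z, logBranch q u

/-- `I₁(Z; θ) + I₄(Z; θ)` for the rectangular lattices, where
`I_j(Z; θ) = i ∫₀^Z log ((-1)^j ϑ_j((u + iθ)/(2i)) / ϑ_j((u - iθ)/(2i))) du`. -/
def rectPotential (τ : ℂ) (θ Z : ℝ) : ℂ :=
  logIntegral (fun u => -(theta1 τ ((u + I * θ) / (2 * I)) / theta1 τ ((u - I * θ) / (2 * I)))) Z +
  logIntegral (fun u => theta4 τ ((u + I * θ) / (2 * I)) / theta4 τ ((u - I * θ) / (2 * I))) Z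

/-- The analogue for the `σ`-formulation:
`i ∫₀^Z log (-σ(u + iθ) / σ(u - iθ)) du`. -/
def rhombicPotential (L : PeriodPair) (θ Z : ℝ) : ℂ :=
  logIntegral
    (fun u => -(weierstrassSigma L (u + I * θ) / weierstrassSigma L (u - I * θ))) Z

/-- The action functional `S = ∑_{e = (x, y)} Λ(X, Y; θ_e) + ∑_x Θ_x X` with
`Λ(X, Y; θ) = J(X + Y; θ) + J(X - Y; θ)`, on a finite multigraph with vertex set `V`, edge set `E`
and endpoints `src e`, `tgt e` of the edge `e`. Since the functions `J(·; θ)` that occur are even,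
`Λ` is symmetric and the order of the two endpoints is irrelevant. -/
def action {V E : Type*} [Fintype V] [Fintype E] (src tgt : E → V) (J : ℝ → ℝ → ℂ)
    (θ : E → ℝ) (Θ : V → ℝ) (X : V → ℝ) : ℂ :=
  ∑ e, (J (θ e) (X (src e) + X (tgt e)) + J (θ e) (X (src e) - X (tgt e))) +
    ∑ x, (Θ x : ℂ) * (X x : ℂ)

/-- The multigraph given by `src`, `tgt` is connected. -/
def IsConnected {V E : Type*} (src tgt : E → V) : Prop :=
  (SimpleGraph.fromRel fun x y => ∃ e, src e = x ∧ tgt e = y).Connected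

/-! ### Dirichlet boundary value problems -/

/-- The assignments whose values on `B` are prescribed by `b`. -/
def dirichletSet {V : Type*} (B : Set V) (b : V → ℝ) : Set (V → ℝ) :=
  {X | ∀ x ∈ B, X x = b x}

/-- The functional `S` is real-valued, it has an extremum under the constraint that the variables
in `B` have the prescribed values `b`, and there is no other (not even a local) extremum under this
constraint. -/
def DirichletUniquelySolvable {V : Type*} (S : (V → ℝ) → ℂ) (B : Set V) (b : V → ℝ) : Prop :=
  (∀ X, (S X).im = 0) ∧
  ∃ X ∈ dirichletSet B b, IsExtrOn (fun Y => (S Y).re) (dirichletSet B b) X ∧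
    ∀ X' ∈ dirichletSet B b, IsLocalExtrOn (fun Y => (S Y).re) (dirichletSet B b) X' → X' = X

/-! ### Convexity conditions -/

/-- `S¹₊`, the open upper half of the unit circle. -/
def upperCircle : Set ℂ := {z | ‖z‖ = 1 ∧ 0 < z.im}

/-- `S¹₋`, the open lower half of the unit circle. -/
def lowerCircle : Set ℂ := {z | ‖z‖ = 1 ∧ z.im < 0}

/-- The convexity condition for rectangular lattices. -/
def RectConvexLabels {E : Type*} (θ : E → ℝ) : Prop :=
  (∀ e, cexp (I * θ e) ∈ upperCircle) ∨ (∀ e, cexp (I * θ e) ∈ lowerCircle)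

/-- The convexity condition for rhombic lattices: `Im (ζ(Z + iθ_e) - ζ(Z - iθ_e))` is defined and
nonzero for all edges `e` and all real `Z`, and always has the same sign. -/
def RhombicConvexLabels {E : Type*} (L : PeriodPair) (θ : E → ℝ) : Prop :=
  (∀ e, ∀ Z : ℝ, (Z : ℂ) + I * θ e ∉ L.lattice) ∧
  ((∀ e, ∀ Z : ℝ, (weierstrassZeta L (Z + I * θ e) - weierstrassZeta L (Z - I * θ e)).im < 0) ∨
   (∀ e, ∀ Z : ℝ, 0 < (weierstrassZeta L (Z + I * θ e) - weierstrassZeta L (Z - I * θ e)).im))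

end QuadFour

end

noncomputable section

namespace QuadFour

open Filter Set ComplexConjugate

/-! ### Strictly convex coercive functions under Dirichlet constraints -/

/-! Up to sign, the action is strictly convex and coercive. On the real line each edge potential is
the double integral of a real, continuous, periodic function `g e` without zeros, whose sign is the
same for all edges. Periodicity and finiteness of the edge set give a uniform `m > 0` with `m ≤ g e`
or `m ≤ -g e`. After replacing the action by its negative if necessary, every potential is strictly
convex and at least `(m / 2) Z ^ 2`. Since `X + Y` and `X - Y` determine `X` and `Y`, and every
vertex lies on an edge, the whole action is strictly convex and dominates a positive definite
quadratic form up to a linear term. Hence a minimum exists on the affine constraint set. It is the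
only local minimum, and a local maximum is possible only if that set is a point
(`dirichletUniquelySolvable_of_periodic`).

What remains is to find `g e`. Reality holds because numerator and denominator of the quotient under
the logarithm are complex conjugate up to a constant, so its logarithmic derivative is purely
imaginary.

In the rectangular case the sign comes from the Jacobi triple product: for imaginary `τ`, every
factor contributes to the second derivative with the sign of `sin θ`
(`neg_im_mul_re_logDeriv_factor_pos`, `jacobiTheta₂_ne_zero_and_re_pos`). The quasi-period `τ`
changes the logarithmic derivative of theta by an imaginary constant only, which gives periodicity.

In the rhombic case the sign is the hypothesis. The lattice is stable under conjugation, which gives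
reality. Periodicity follows from `ζ' = -℘` (`hasDerivAt_weierstrassZeta`) and the evenness of `ζ(x
+ iθ) - ζ(x - iθ)` (`IsRhombic.periodic_zetaDifference`). -/

theorem convex_dirichletSet {V : Type*} (B : Set V) (b : V → ℝ) :
    Convex ℝ (dirichletSet B b) := by
  intro X hX Y hY s t _ _ hst x hx
  simp only [Pi.add_apply, Pi.smul_apply, smul_eq_mul, hX x hx, hY x hx]
  rw [← add_mul, hst, one_mul]

theorem isClosed_dirichletSet {V : Type*} (B : Set V) (b : V → ℝ) :
    IsClosed (dirichletSet B b) := by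
  have : dirichletSet B b = ⋂ x ∈ B, {X : V → ℝ | X x = b x} := by
    ext X; simp [dirichletSet]
  rw [this]
  exact isClosed_biInter fun x _ => isClosed_eq (continuous_apply x) continuous_const

/-- A strictly convex function has no local maximum on an affine constraint set, unless that set
is a single point. -/
theorem eq_of_isLocalMaxOn_dirichletSet {V : Type*} {f : (V → ℝ) → ℝ}
    (hf : StrictConvexOn ℝ univ f) {B : Set V} {b X Y : V → ℝ} (hX : X ∈ dirichletSet B b)
    (hY : Y ∈ dirichletSet B b) (hmax : IsLocalMaxOn f (dirichletSet B b) X) : X = Y := by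
  by_contra hne
  have hmem : ∀ t : ℝ, X + t • (Y - X) ∈ dirichletSet B b := fun t x hx => by
    simp [hX x hx, hY x hx]
  have hc : Tendsto (fun t : ℝ => X + t • (Y - X)) (𝓝 0) (𝓝[dirichletSet B b] X) := by
    refine tendsto_nhdsWithin_iff.2 ⟨?_, Eventually.of_forall hmem⟩
    have : Continuous fun t : ℝ => X + t • (Y - X) := by fun_prop
    simpa using this.tendsto 0
  have h1 := hc.eventually hmax
  have h2 : ∀ᶠ t : ℝ in 𝓝 0, f (X + (-t) • (Y - X)) ≤ f X := by
    have hn : Tendsto (fun t : ℝ => -t) (𝓝 0) (𝓝 0) := by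
      simpa using (continuous_neg (G := ℝ)).tendsto 0
    exact hn.eventually h1
  -- For small `t > 0` both points `X ± t (Y - X)` are admissible with values at most `f X`; their
  -- midpoint is `X`, contradicting strict convexity.
  obtain ⟨t, ⟨ht1, ht2⟩, ht0⟩ := (((h1.and h2).filter_mono nhdsWithin_le_nhds).and
    (self_mem_nhdsWithin : Ioi (0 : ℝ) ∈ 𝓝[>] (0 : ℝ))).exists
  have ht0 : (0 : ℝ) < t := ht0
  have hd : X + t • (Y - X) ≠ X + (-t) • (Y - X) := by
    intro h
    have h3 : (2 * t) • (Y - X) = 0 := by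
      have := add_left_cancel h
      rw [neg_smul, ← sub_eq_zero, sub_neg_eq_add, ← add_smul] at this
      rwa [two_mul]
    rcases smul_eq_zero.1 h3 with h4 | h4
    · linarith
    · exact hne (sub_eq_zero.1 h4).symm
  have := hf.2 (mem_univ _) (mem_univ _) hd one_half_pos one_half_pos (add_halves 1)
  have hmid : (1 / 2 : ℝ) • (X + t • (Y - X)) + (1 / 2 : ℝ) • (X + (-t) • (Y - X)) = X := by
    ext x; simp; ring
  rw [hmid] at this
  simp only [smul_eq_mul] at this
  linarith

theorem exists_unique_extremum {V : Type*} [Fintype V] {f : (V → ℝ) → ℝ}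
    (hf : StrictConvexOn ℝ univ f) (hc : Continuous f) (ht : Tendsto f (cocompact (V → ℝ)) atTop)
    (B : Set V) (b : V → ℝ) :
    ∃ X ∈ dirichletSet B b, IsMinOn f (dirichletSet B b) X ∧
      ∀ X' ∈ dirichletSet B b, IsLocalExtrOn f (dirichletSet B b) X' → X' = X := by
  have hb : b ∈ dirichletSet B b := fun _ _ => rfl
  obtain ⟨X, hX, hmin⟩ := hc.continuousOn.exists_isMinOn' (isClosed_dirichletSet B b) hb
    ((ht.eventually_ge_atTop (f b)).filter_mono inf_le_left)
  refine ⟨X, hX, hmin, fun X' hX' h => ?_⟩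
  have hs := hf.subset (subset_univ (dirichletSet B b)) (convex_dirichletSet B b)
  rcases h with h | h
  · exact hs.eq_of_isMinOn (IsMinOn.of_isLocalMinOn_of_convexOn hX' h hs.convexOn) hmin hX' hX
  · exact eq_of_isLocalMaxOn_dirichletSet hf hX' hX h

/-! ### Actions with uniformly convex edge potentials -/

/-- The real action functional with edge potentials `K e`. -/
def realAction {V E : Type*} [Fintype V] [Fintype E] (src tgt : E → V) (K : E → ℝ → ℝ)
    (Θ : V → ℝ) (X : V → ℝ) : ℝ :=
  ∑ e, (K e (X (src e) + X (tgt e)) + K e (X (src e) - X (tgt e))) + ∑ x, Θ x * X x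

/-- The only consequence of connectedness that is needed: no vertex is isolated. -/
theorem IsConnected.exists_edge {V E : Type*} [Nontrivial V] {src tgt : E → V}
    (h : IsConnected src tgt) (x : V) : ∃ e, src e = x ∨ tgt e = x := by
  have hx : x ∈ (SimpleGraph.fromRel fun x y => ∃ e, src e = x ∧ tgt e = y).support := by
    rw [SimpleGraph.Preconnected.support_eq_univ h.preconnected]; trivial
  obtain ⟨y, hy⟩ := (SimpleGraph.mem_support _).1 hx
  rw [SimpleGraph.fromRel_adj] at hy
  rcases hy.2 with ⟨e, he⟩ | ⟨e, he⟩
  · exact ⟨e, Or.inl he.1⟩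
  · exact ⟨e, Or.inr he.2⟩

section

variable {V E : Type*} [Fintype V] [Fintype E] {src tgt : E → V} {K : E → ℝ → ℝ} {Θ : V → ℝ}

theorem continuous_realAction (hc : ∀ e, Continuous (K e)) :
    Continuous (realAction src tgt K Θ) := by
  unfold realAction
  fun_prop

theorem strictConvexOn_realAction (hE : ∀ x, ∃ e, src e = x ∨ tgt e = x)
    (hK : ∀ e, StrictConvexOn ℝ univ (K e)) :
    StrictConvexOn ℝ univ (realAction src tgt K Θ) := by
  refine ⟨convex_univ, fun X _ Y _ hXY s t hs ht hst => ?_⟩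
  have hle : ∀ e (x y : ℝ), K e (s * x + t * y) ≤ s * K e x + t * K e y := fun e x y =>
    (hK e).convexOn.2 (mem_univ x) (mem_univ y) hs.le ht.le hst
  have hlt : ∀ e (x y : ℝ), x ≠ y → K e (s * x + t * y) < s * K e x + t * K e y :=
    fun e x y h => (hK e).2 (mem_univ x) (mem_univ y) h hs ht hst
  have hadd : ∀ e, (s • X + t • Y) (src e) + (s • X + t • Y) (tgt e) =
      s * (X (src e) + X (tgt e)) + t * (Y (src e) + Y (tgt e)) := fun e => by simp; ring
  have hsub : ∀ e, (s • X + t • Y) (src e) - (s • X + t • Y) (tgt e) =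
      s * (X (src e) - X (tgt e)) + t * (Y (src e) - Y (tgt e)) := fun e => by simp; ring
  have hlin : ∑ x, Θ x * (s • X + t • Y) x = s * ∑ x, Θ x * X x + t * ∑ x, Θ x * Y x := by
    rw [Finset.mul_sum, Finset.mul_sum, ← Finset.sum_add_distrib]
    exact Finset.sum_congr rfl fun x _ => by simp; ring
  obtain ⟨x, hx⟩ := Function.ne_iff.1 hXY
  obtain ⟨e₀, he₀⟩ := hE x
  have key : ∑ e, (K e ((s • X + t • Y) (src e) + (s • X + t • Y) (tgt e)) +
        K e ((s • X + t • Y) (src e) - (s • X + t • Y) (tgt e))) <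
      s * ∑ e, (K e (X (src e) + X (tgt e)) + K e (X (src e) - X (tgt e))) +
        t * ∑ e, (K e (Y (src e) + Y (tgt e)) + K e (Y (src e) - Y (tgt e))) := by
    rw [Finset.mul_sum, Finset.mul_sum, ← Finset.sum_add_distrib]
    refine Finset.sum_lt_sum (fun e _ => ?_) ⟨e₀, Finset.mem_univ _, ?_⟩
    · rw [hadd, hsub]
      linarith [hle e (X (src e) + X (tgt e)) (Y (src e) + Y (tgt e)),
        hle e (X (src e) - X (tgt e)) (Y (src e) - Y (tgt e))]
    · rw [hadd, hsub]
      -- If both the sums and the differences agreed, `X` and `Y` would agree at both endpoints of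
      -- `e₀`, in particular at `x`. So one of the two inequalities at `e₀` is strict.
      by_cases h : X (src e₀) + X (tgt e₀) = Y (src e₀) + Y (tgt e₀)
      · have h' : X (src e₀) - X (tgt e₀) ≠ Y (src e₀) - Y (tgt e₀) := by
          intro h'
          rcases he₀ with rfl | rfl
          · exact hx (by linarith)
          · exact hx (by linarith)
        linarith [hle e₀ (X (src e₀) + X (tgt e₀)) (Y (src e₀) + Y (tgt e₀)), hlt e₀ _ _ h']
      · linarith [hlt e₀ _ _ h,
          hle e₀ (X (src e₀) - X (tgt e₀)) (Y (src e₀) - Y (tgt e₀))]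
  unfold realAction
  rw [hlin]
  simp only [smul_eq_mul]
  linarith

/-- By the parallelogram law `(x + y)² + (x - y)² = 2x² + 2y²`, an edge at a vertex where `|X x|`
equals the sup norm already contributes `2m‖X‖²`, which beats the linear term. -/
theorem tendsto_realAction (hE : ∀ x, ∃ e, src e = x ∨ tgt e = x) {m : ℝ} (hm : 0 < m)
    (hK : ∀ e Z, m * Z ^ 2 ≤ K e Z) :
    Tendsto (realAction src tgt K Θ) (cocompact (V → ℝ)) atTop := by
  set C := ∑ x, |Θ x|
  have hlow : ∀ X : V → ℝ, ‖X‖ * (2 * m * ‖X‖ + -C) ≤ realAction src tgt K Θ X := by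
    intro X
    have h1 : ∀ x, |X x| ≤ √((2 * m)⁻¹ *
        ∑ e, (K e (X (src e) + X (tgt e)) + K e (X (src e) - X (tgt e)))) := by
      intro x
      refine Real.abs_le_sqrt ?_
      rw [inv_mul_eq_div, le_div_iff₀ (by positivity)]
      obtain ⟨e, he⟩ := hE x
      have hnn : ∀ e, 2 * m * (X (src e) ^ 2 + X (tgt e) ^ 2) ≤
          K e (X (src e) + X (tgt e)) + K e (X (src e) - X (tgt e)) := fun e => by
        linarith [hK e (X (src e) + X (tgt e)), hK e (X (src e) - X (tgt e))]
      refine le_trans ?_ (Finset.single_le_sum (fun e _ => le_trans (by positivity) (hnn e))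
        (Finset.mem_univ e))
      refine le_trans ?_ (hnn e)
      rcases he with rfl | rfl <;>
        nlinarith [mul_nonneg hm.le (sq_nonneg (X (src e))), mul_nonneg hm.le (sq_nonneg (X (tgt e)))]
    have h2 : ‖X‖ ≤ √((2 * m)⁻¹ *
        ∑ e, (K e (X (src e) + X (tgt e)) + K e (X (src e) - X (tgt e)))) :=
      (pi_norm_le_iff_of_nonneg (Real.sqrt_nonneg _)).2 h1
    have hS : 0 ≤ ∑ e, (K e (X (src e) + X (tgt e)) + K e (X (src e) - X (tgt e))) :=
      Finset.sum_nonneg fun e _ => add_nonneg (le_trans (by positivity) (hK e _))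
        (le_trans (by positivity) (hK e _))
    have h3 : 2 * m * ‖X‖ ^ 2 ≤
        ∑ e, (K e (X (src e) + X (tgt e)) + K e (X (src e) - X (tgt e))) := by
      have := (Real.le_sqrt (norm_nonneg X) (by positivity)).1 h2
      rwa [inv_mul_eq_div, le_div_iff₀ (by positivity), mul_comm] at this
    have h4 : -(C * ‖X‖) ≤ ∑ x, Θ x * X x := by
      have : |∑ x, Θ x * X x| ≤ C * ‖X‖ := by
        refine (Finset.abs_sum_le_sum_abs _ _).trans ?_
        rw [Finset.sum_mul]
        refine Finset.sum_le_sum fun x _ => ?_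
        rw [abs_mul]
        exact mul_le_mul_of_nonneg_left (norm_le_pi_norm X x) (abs_nonneg _)
      exact neg_le_of_abs_le this
    unfold realAction
    nlinarith
  refine tendsto_atTop_mono hlow ?_
  have hn := tendsto_norm_cocompact_atTop (E := V → ℝ)
  exact hn.atTop_mul_atTop₀ (tendsto_atTop_add_const_right _ _ (hn.const_mul_atTop (by positivity)))

end

/-! ### Iterated integrals -/

/-- The function with second derivative `g` that vanishes to second order at `0`. -/
def doubleIntegral (g : ℝ → ℝ) (Z : ℝ) : ℝ :=
  ∫ u in (0 : ℝ)..Z, ∫ s in (0 : ℝ)..u, g s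

section

variable {g : ℝ → ℝ}

theorem continuous_integral (hg : Continuous g) : Continuous fun u => ∫ s in (0 : ℝ)..u, g s :=
  continuous_iff_continuousAt.2 fun u => (hg.integral_hasStrictDerivAt 0 u).hasDerivAt.continuousAt

theorem hasDerivAt_doubleIntegral (hg : Continuous g) (Z : ℝ) :
    HasDerivAt (doubleIntegral g) (∫ s in (0 : ℝ)..Z, g s) Z :=
  ((continuous_integral hg).integral_hasStrictDerivAt 0 Z).hasDerivAt

theorem continuous_doubleIntegral (hg : Continuous g) : Continuous (doubleIntegral g) :=
  continuous_iff_continuousAt.2 fun u => (hasDerivAt_doubleIntegral hg u).continuousAt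

theorem strictConvexOn_doubleIntegral (hg : Continuous g) (hpos : ∀ x, 0 < g x) :
    StrictConvexOn ℝ univ (doubleIntegral g) := by
  refine strictConvexOn_univ_of_deriv2_pos (continuous_doubleIntegral hg) fun x => ?_
  have h1 : deriv (doubleIntegral g) = fun u => ∫ s in (0 : ℝ)..u, g s :=
    funext fun u => (hasDerivAt_doubleIntegral hg u).deriv
  simp only [Function.iterate_succ, Function.iterate_zero, Function.comp_apply, id_eq, h1]
  rw [(hg.integral_hasStrictDerivAt 0 x).hasDerivAt.deriv]
  exact hpos x

/-- The difference of the two sides has derivative `∫₀^x (g - m)`, which has the sign of `x`, so its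
minimum is its value `0` at the origin. -/
theorem le_doubleIntegral (hg : Continuous g) {m : ℝ} (hm : ∀ x, m ≤ g x) (Z : ℝ) :
    m / 2 * Z ^ 2 ≤ doubleIntegral g Z := by
  have hd : ∀ x, HasDerivAt (fun Z => doubleIntegral g Z - m / 2 * Z ^ 2)
      (∫ s in (0 : ℝ)..x, (g s - m)) x := fun x => by
    have := (hasDerivAt_doubleIntegral hg x).sub (((hasDerivAt_id x).pow 2).const_mul (m / 2))
    convert! this using 1
    rw [intervalIntegral.integral_sub (hg.intervalIntegrable _ _) (by simp)]
    simp; ring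
  have hc : Continuous fun Z => doubleIntegral g Z - m / 2 * Z ^ 2 :=
    continuous_iff_continuousAt.2 fun u => (hd u).continuousAt
  have h0 : doubleIntegral g 0 = 0 := by simp [doubleIntegral]
  rcases le_total 0 Z with hZ | hZ
  · have hmono : MonotoneOn (fun Z => doubleIntegral g Z - m / 2 * Z ^ 2) (Ici 0) := by
      refine monotoneOn_of_deriv_nonneg (convex_Ici 0) hc.continuousOn
        (fun x _ => (hd x).differentiableAt.differentiableWithinAt) fun x hx => ?_
      rw [(hd x).deriv]
      rw [interior_Ici] at hx
      exact intervalIntegral.integral_nonneg (le_of_lt hx) fun u _ => sub_nonneg.2 (hm u)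
    have := hmono self_mem_Ici hZ hZ
    simp [h0] at this; linarith
  · have hmono : AntitoneOn (fun Z => doubleIntegral g Z - m / 2 * Z ^ 2) (Iic 0) := by
      refine antitoneOn_of_deriv_nonpos (convex_Iic 0) hc.continuousOn
        (fun x _ => (hd x).differentiableAt.differentiableWithinAt) fun x hx => ?_
      rw [(hd x).deriv, intervalIntegral.integral_symm, neg_nonpos]
      rw [interior_Iic] at hx
      exact intervalIntegral.integral_nonneg (le_of_lt hx) fun u _ => sub_nonneg.2 (hm u)
    have := hmono hZ self_mem_Iic hZ
    simp [h0] at this; linarith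

theorem doubleIntegral_neg (g : ℝ → ℝ) (Z : ℝ) :
    doubleIntegral (fun x => -g x) Z = -doubleIntegral g Z := by
  simp [doubleIntegral]

end

theorem dirichletUniquelySolvable_of_le {V E : Type*} [Fintype V] [Nontrivial V] [Fintype E]
    {src tgt : E → V} (hconn : IsConnected src tgt) {J : ℝ → ℝ → ℂ} {θ : E → ℝ} (Θ : V → ℝ)
    (B : Set V) (b : V → ℝ) {g : E → ℝ → ℝ} (hg : ∀ e, Continuous (g e))
    (hJ : ∀ e Z, J (θ e) Z = doubleIntegral (g e) Z) {m : ℝ} (hm : 0 < m)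
    (h : (∀ e Z, m ≤ g e Z) ∨ (∀ e Z, m ≤ -g e Z)) :
    DirichletUniquelySolvable (action src tgt J θ Θ) B b := by
  have hS : ∀ X, action src tgt J θ Θ X =
      (realAction src tgt (fun e => doubleIntegral (g e)) Θ X : ℝ) := fun X => by
    simp [action, realAction, hJ]
  have hE := hconn.exists_edge
  refine ⟨fun X => by rw [hS, ofReal_im], ?_⟩
  simp only [hS, ofReal_re]
  rcases h with h | h
  · obtain ⟨X, hX, h1, h2⟩ := exists_unique_extremum (f := realAction src tgt
      (fun e => doubleIntegral (g e)) Θ) (strictConvexOn_realAction hE fun e =>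
        strictConvexOn_doubleIntegral (hg e) fun x => hm.trans_le (h e x))
      (continuous_realAction fun e => continuous_doubleIntegral (hg e))
      (tendsto_realAction hE (half_pos hm) fun e => le_doubleIntegral (hg e) (h e)) B b
    exact ⟨X, hX, Or.inl h1, h2⟩
  -- Concave case: the negative of the action is an action of the convex kind, with `-g` and `-Θ`.
  -- Minima and maxima are exchanged.
  · have hneg : realAction src tgt (fun e => doubleIntegral (g e)) Θ =
        fun X => -realAction src tgt (fun e => doubleIntegral fun x => -g e x) (-Θ) X := by
      ext X
      simp only [realAction, doubleIntegral_neg, Pi.neg_apply, neg_mul, Finset.sum_neg_distrib,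
        ← neg_add, neg_neg]
    have hg' := fun e => (hg e).neg
    obtain ⟨X, hX, h1, h2⟩ := exists_unique_extremum (f := realAction src tgt
      (fun e => doubleIntegral fun x => -g e x) (-Θ)) (strictConvexOn_realAction hE fun e =>
        strictConvexOn_doubleIntegral (hg' e) fun x => hm.trans_le (h e x))
      (continuous_realAction fun e => continuous_doubleIntegral (hg' e))
      (tendsto_realAction hE (half_pos hm) fun e => le_doubleIntegral (hg' e) (h e)) B b
    rw [hneg]
    refine ⟨X, hX, Or.inr h1.neg, fun X' hX' h' => h2 X' hX' ?_⟩
    rcases h' with h' | h'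
    · exact Or.inr (by simpa using h'.neg)
    · exact Or.inl (by simpa using h'.neg)

theorem exists_pos_le_of_periodic {g : ℝ → ℝ} (hg : Continuous g) {T : ℝ} (hT : T ≠ 0)
    (hp : Function.Periodic g T) (hpos : ∀ x, 0 < g x) : ∃ m > 0, ∀ x, m ≤ g x := by
  obtain ⟨y, hy⟩ := (hp.compact_of_continuous hT hg).exists_isLeast (range_nonempty g)
  obtain ⟨x, hx⟩ := hy.1
  exact ⟨y, hx ▸ hpos x, fun z => hy.2 ⟨z, rfl⟩⟩

/-- Unique solvability of the Dirichlet problem when the second derivatives of the edge potentials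
are periodic and either all positive or all negative. -/
theorem dirichletUniquelySolvable_of_periodic {V E : Type*} [Fintype V] [Nontrivial V] [Fintype E]
    {src tgt : E → V} (hconn : IsConnected src tgt) {J : ℝ → ℝ → ℂ} {θ : E → ℝ} (Θ : V → ℝ)
    (B : Set V) (b : V → ℝ) {g : E → ℝ → ℝ} (hg : ∀ e, Continuous (g e))
    (hJ : ∀ e Z, J (θ e) Z = doubleIntegral (g e) Z) {T : ℝ} (hT : T ≠ 0)
    (hp : ∀ e, Function.Periodic (g e) T)
    (h : (∀ e Z, 0 < g e Z) ∨ (∀ e Z, g e Z < 0)) :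
    DirichletUniquelySolvable (action src tgt J θ Θ) B b := by
  -- Needed to choose the edge with the smallest lower bound.
  have : Nonempty E := (hconn.exists_edge (Classical.arbitrary V)).nonempty
  have aux : ∀ f : E → ℝ → ℝ, (∀ e, Continuous (f e)) → (∀ e, Function.Periodic (f e) T) →
      (∀ e Z, 0 < f e Z) → ∃ m > 0, ∀ e Z, m ≤ f e Z := fun f hf hfp hpos => by
    choose m hm hle using fun e => exists_pos_le_of_periodic (hf e) hT (hfp e) (hpos e)
    obtain ⟨e₀, he₀⟩ := Finite.exists_min m
    exact ⟨m e₀, hm e₀, fun e Z => (he₀ e).trans (hle e Z)⟩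
  rcases h with h | h
  · obtain ⟨m, hm, hle⟩ := aux g hg hp h
    exact dirichletUniquelySolvable_of_le hconn Θ B b hg hJ hm (Or.inl hle)
  · obtain ⟨m, hm, hle⟩ := aux (fun e x => -g e x) (fun e => (hg e).neg)
      (fun e x => by simp only [hp e x]) (fun e Z => neg_pos.2 (h e Z))
    exact dirichletUniquelySolvable_of_le hconn Θ B b hg hJ hm (Or.inr hle)

/-- If `q' / q = i g` on the real line with `g` real, then `i ∫ log q` is real with second
derivative `-g`. -/
theorem logIntegral_eq {q : ℂ → ℂ} {g : ℝ → ℝ} (h : ∀ x : ℝ, deriv q x / q x = I * g x) (Z : ℝ) :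
    logIntegral q Z = doubleIntegral (fun x => -g x) Z := by
  have h1 : logBranch q = fun u => I * ((∫ s in (0 : ℝ)..u, g s : ℝ) : ℂ) := by
    ext u
    rw [logBranch, ← intervalIntegral.integral_ofReal, ← intervalIntegral.integral_const_mul]
    simp only [h]
  rw [logIntegral, h1, intervalIntegral.integral_const_mul, ← mul_assoc, I_mul_I,
    intervalIntegral.integral_ofReal, doubleIntegral_neg, doubleIntegral]
  simp

/-! ### The Jacobi triple product -/

/-- The `q`-Pochhammer symbol `(x; x)_n`. -/
def qPoch (x : ℝ) (n : ℕ) : ℝ := ∏ k ∈ Finset.range n, (1 - x ^ (k + 1))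

/-- The reciprocal of `(x; x)_n`, extended by zero to negative `n`. -/
def qPochInv (x : ℝ) (n : ℤ) : ℝ := if 0 ≤ n then (qPoch x n.toNat)⁻¹ else 0

section

variable {x : ℝ}

theorem qPoch_succ (n : ℕ) : qPoch x (n + 1) = qPoch x n * (1 - x ^ (n + 1)) :=
  Finset.prod_range_succ _ _

theorem qPoch_pos (h0 : 0 < x) (h1 : x < 1) (n : ℕ) : 0 < qPoch x n :=
  Finset.prod_pos fun k _ => sub_pos.2 (pow_lt_one₀ h0.le h1 k.succ_ne_zero)

theorem antitone_qPoch (h0 : 0 < x) (h1 : x < 1) : Antitone (qPoch x) :=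
  antitone_nat_of_succ_le fun n => by
    rw [qPoch_succ]
    exact mul_le_of_le_one_right (qPoch_pos h0 h1 n).le (sub_le_self _ (by positivity))

theorem exists_tendsto_qPoch (h0 : 0 < x) (h1 : x < 1) :
    ∃ P > 0, Tendsto (qPoch x) atTop (𝓝 P) := by
  have hs : Summable fun k : ℕ => ‖-x ^ (k + 1)‖ := by
    have := (summable_nat_add_iff 1).2 (summable_geometric_of_lt_one h0.le h1)
    simpa [abs_of_pos h0] using this
  have hne : ∏' k : ℕ, (1 + -x ^ (k + 1)) ≠ 0 :=
    tprod_one_add_ne_zero_of_summable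
      (fun k => by
        rw [← sub_eq_add_neg]
        exact (sub_pos.2 (pow_lt_one₀ h0.le h1 k.succ_ne_zero)).ne') hs
  have ht := (multipliable_one_add_of_summable hs).hasProd.tendsto_prod_nat
  have ht' : Tendsto (qPoch x) atTop (𝓝 (∏' k : ℕ, (1 + -x ^ (k + 1)))) := ht
  exact ⟨_, lt_of_le_of_ne (ge_of_tendsto' ht' fun n => (qPoch_pos h0 h1 n).le) hne.symm, ht'⟩

/-- The extension by zero makes the recursion valid on all of `ℤ`: at `n = 0` the factor `1 - x ^ 0`
vanishes. No boundary cases arise later. -/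
theorem qPochInv_rec (h0 : 0 < x) (h1 : x < 1) (n : ℤ) :
    qPochInv x (n - 1) = (1 - x ^ n) * qPochInv x n := by
  rcases lt_trichotomy n 0 with h | rfl | h
  · rw [qPochInv, qPochInv, if_neg (by omega), if_neg (by omega), mul_zero]
  · simp [qPochInv]
  · obtain ⟨k, rfl⟩ : ∃ k : ℕ, n = k + 1 := ⟨(n - 1).toNat, by omega⟩
    have hp := qPoch_pos h0 h1 k
    have hk : (0 : ℝ) < 1 - x ^ (k + 1) := sub_pos.2 (pow_lt_one₀ h0.le h1 k.succ_ne_zero)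
    have e1 : (k : ℤ) + 1 - 1 = (k : ℤ) := by ring
    have e2 : ((k : ℤ) + 1).toNat = k + 1 := by omega
    rw [e1, qPochInv, if_pos (by omega), qPochInv, if_pos (by omega), e2, Int.toNat_natCast,
      qPoch_succ, show (k : ℤ) + 1 = ((k + 1 : ℕ) : ℤ) by push_cast; ring, zpow_natCast]
    field_simp

theorem abs_qPochInv_le (h0 : 0 < x) (h1 : x < 1) {P : ℝ} (hP : 0 < P)
    (ht : Tendsto (qPoch x) atTop (𝓝 P)) (n : ℤ) : |qPochInv x n| ≤ P⁻¹ := by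
  unfold qPochInv
  split_ifs
  · rw [abs_of_pos (inv_pos.2 (qPoch_pos h0 h1 _))]
    exact inv_anti₀ hP ((antitone_qPoch h0 h1).le_of_tendsto ht _)
  · simpa using hP.le

theorem tendsto_qPochInv {P : ℝ} (hP : 0 < P) (ht : Tendsto (qPoch x) atTop (𝓝 P)) (n : ℤ) :
    Tendsto (fun N : ℕ => qPochInv x (N + n)) atTop (𝓝 P⁻¹) := by
  have h1 : Tendsto (fun N : ℕ => ((N : ℤ) + n).toNat) atTop atTop :=
    tendsto_atTop.2 fun b => by
      filter_upwards [eventually_ge_atTop (b + n.natAbs)] with N hN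
      omega
  refine ((ht.comp h1).inv₀ hP.ne').congr' ?_
  filter_upwards [eventually_ge_atTop n.natAbs] with N hN
  simp [qPochInv, show 0 ≤ (N : ℤ) + n by omega]

end

/-- The coefficients of the finite triple product. -/
def tripleCoeff (q : ℝ) (N : ℕ) (n : ℤ) : ℝ :=
  qPoch (q ^ 2) (2 * N) * qPochInv (q ^ 2) (N + n) * qPochInv (q ^ 2) (N - n)

section

variable {q : ℝ}

/-- This is multiplication by `(1 + q^(2N+1) w)(1 + q^(2N+1) w⁻¹)`, read off at `w ^ n` after
removing `q ^ (n²)`. All reciprocals are reduced to those with index `N + 1 ± n`, leaving a rational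
identity in `q`, `q ^ N` and `q ^ n`. -/
theorem tripleCoeff_succ (h0 : 0 < q) (h1 : q < 1) (N : ℕ) (n : ℤ) :
    tripleCoeff q (N + 1) n = (1 + q ^ (4 * N + 2)) * tripleCoeff q N n +
      q ^ (2 * N + 1) * (q ^ (1 - 2 * n) * tripleCoeff q N (n - 1) +
        q ^ (1 + 2 * n) * tripleCoeff q N (n + 1)) := by
  have hx0 : 0 < q ^ 2 := by positivity
  have hx1 : q ^ 2 < 1 := pow_lt_one₀ h0.le h1 two_ne_zero
  have r1 := qPochInv_rec hx0 hx1 ((N : ℤ) + 1 + n)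
  have r2 := qPochInv_rec hx0 hx1 ((N : ℤ) + n)
  have r3 := qPochInv_rec hx0 hx1 ((N : ℤ) + 1 - n)
  have r4 := qPochInv_rec hx0 hx1 ((N : ℤ) - n)
  have f1 : (N : ℤ) + 1 + n - 1 = N + n := by ring
  have f3 : (N : ℤ) + 1 - n - 1 = N - n := by ring
  rw [f1] at r1
  rw [f3] at r3
  have e1 : (N : ℤ) + (n - 1) = N + n - 1 := by ring
  have e2 : (N : ℤ) - (n - 1) = N + 1 - n := by ring
  have e3 : (N : ℤ) + (n + 1) = N + 1 + n := by ring
  have e4 : (N : ℤ) - (n + 1) = N - n - 1 := by ring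
  have hp : qPoch (q ^ 2) (2 * (N + 1)) =
      qPoch (q ^ 2) (2 * N) * (1 - (q ^ 2) ^ (2 * N + 1)) * (1 - (q ^ 2) ^ (2 * N + 2)) := by
    rw [show 2 * (N + 1) = 2 * N + 1 + 1 by ring, qPoch_succ, qPoch_succ]
  unfold tripleCoeff
  rw [e1, e2, e3, e4, r2, r4, r1, r3, hp]
  push_cast
  have hq : q ≠ 0 := h0.ne'
  have hB : q ^ n ≠ 0 := zpow_ne_zero _ hq
  have z1 : (q ^ 2) ^ ((N : ℤ) + 1 + n) = q ^ 2 * (q ^ N) ^ 2 * (q ^ n) ^ 2 := by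
    rw [zpow_add₀ hx0.ne', zpow_add₀ hx0.ne', zpow_natCast, zpow_one, ← zpow_natCast q 2,
      ← zpow_mul, mul_comm _ n, zpow_mul, zpow_natCast, zpow_natCast, ← pow_mul, ← pow_mul]
    ring
  have z2 : (q ^ 2) ^ ((N : ℤ) + n) = (q ^ N) ^ 2 * (q ^ n) ^ 2 := by
    rw [zpow_add₀ hx0.ne', zpow_natCast, ← zpow_natCast q 2,
      ← zpow_mul, mul_comm _ n, zpow_mul, zpow_natCast, zpow_natCast, ← pow_mul, ← pow_mul]
    ring
  have z3 : (q ^ 2) ^ ((N : ℤ) + 1 - n) = q ^ 2 * (q ^ N) ^ 2 / (q ^ n) ^ 2 := by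
    rw [zpow_sub₀ hx0.ne', zpow_add₀ hx0.ne', zpow_natCast, zpow_one, ← zpow_natCast q 2,
      ← zpow_mul, mul_comm _ n, zpow_mul, zpow_natCast, zpow_natCast, ← pow_mul, ← pow_mul]
    ring
  have z4 : (q ^ 2) ^ ((N : ℤ) - n) = (q ^ N) ^ 2 / (q ^ n) ^ 2 := by
    rw [zpow_sub₀ hx0.ne', zpow_natCast, ← zpow_natCast q 2,
      ← zpow_mul, mul_comm _ n, zpow_mul, zpow_natCast, zpow_natCast, ← pow_mul, ← pow_mul]
    ring
  have z5 : q ^ (1 - 2 * n) = q / (q ^ n) ^ 2 := by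
    rw [zpow_sub₀ hq, zpow_one, mul_comm, zpow_mul]; norm_cast
  have z6 : q ^ (1 + 2 * n) = q * (q ^ n) ^ 2 := by
    rw [zpow_add₀ hq, zpow_one, mul_comm 2, zpow_mul]; norm_cast
  have z7 : q ^ (4 * N + 2) = q ^ 2 * (q ^ N) ^ 4 := by ring
  have z8 : q ^ (2 * N + 1) = q * (q ^ N) ^ 2 := by ring
  have z9 : (q ^ 2) ^ (2 * N + 1) = q ^ 2 * (q ^ N) ^ 4 := by ring
  have z10 : (q ^ 2) ^ (2 * N + 2) = q ^ 4 * (q ^ N) ^ 4 := by ring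
  rw [z1, z2, z3, z4, z5, z6, z7, z8, z9, z10]
  generalize q ^ n = B at *
  generalize q ^ N = A at *
  field_simp
  ring

theorem hasSum_finite_triple_product (h0 : 0 < q) (h1 : q < 1) {w : ℂ} (hw : w ≠ 0) (N : ℕ) :
    HasSum (fun n : ℤ => (tripleCoeff q N n : ℂ) * ((q : ℂ) ^ (n ^ 2) * w ^ n))
      (∏ k ∈ Finset.range N, (1 + (q : ℂ) ^ (2 * k + 1) * w) * (1 + (q : ℂ) ^ (2 * k + 1) * w⁻¹)) := by
  have hq : (q : ℂ) ≠ 0 := ofReal_ne_zero.2 h0.ne'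
  induction N with
  | zero =>
    have : ∀ n : ℤ, n ≠ 0 → (tripleCoeff q 0 n : ℂ) * ((q : ℂ) ^ (n ^ 2) * w ^ n) = 0 := by
      intro n hn
      have : tripleCoeff q 0 n = 0 := by
        rcases lt_or_gt_of_ne hn with h | h
        · simp [tripleCoeff, qPochInv, not_le.2 h]
        · simp [tripleCoeff, qPochInv, not_le.2 h]
      simp [this]
    have h := hasSum_single (0 : ℤ) this
    simpa [tripleCoeff, qPochInv, qPoch] using h
  | succ N ih =>
    have hm := (Equiv.subRight (1 : ℤ)).hasSum_iff.2 ih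
    have hp := (Equiv.addRight (1 : ℤ)).hasSum_iff.2 ih
    have h := (ih.mul_left (1 + (q : ℂ) ^ (4 * N + 2))).add
      ((hm.mul_left ((q : ℂ) ^ (2 * N + 1) * w)).add (hp.mul_left ((q : ℂ) ^ (2 * N + 1) * w⁻¹)))
    convert! h using 1
    · ext n
      simp only [Function.comp_apply, Equiv.subRight_apply, Equiv.coe_addRight]
      rw [tripleCoeff_succ h0 h1]
      have z1 : (q : ℂ) ^ ((n - 1) ^ 2) = (q : ℂ) ^ (n ^ 2) * (q : ℂ) ^ (1 - 2 * n) := by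
        rw [← zpow_add₀ hq]; congr 1; ring
      have z2 : (q : ℂ) ^ ((n + 1) ^ 2) = (q : ℂ) ^ (n ^ 2) * (q : ℂ) ^ (1 + 2 * n) := by
        rw [← zpow_add₀ hq]; congr 1; ring
      rw [z1, z2, zpow_sub_one₀ hw, zpow_add_one₀ hw]
      push_cast
      generalize (q : ℂ) ^ (1 - 2 * n) = C at *
      generalize (q : ℂ) ^ (1 + 2 * n) = D at *
      field_simp
    · rw [Finset.prod_range_succ]
      generalize ∏ k ∈ Finset.range N, (1 + (q : ℂ) ^ (2 * k + 1) * w) *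
        (1 + (q : ℂ) ^ (2 * k + 1) * w⁻¹) = F
      field_simp
      ring

/-- Dominated convergence in the finite triple product: the coefficients are bounded by `P⁻¹ * P⁻¹`
and tend to `P * P⁻¹ * P⁻¹ = P⁻¹`. -/
theorem tendsto_triple_product (h0 : 0 < q) (h1 : q < 1) {w : ℂ} (hw : w ≠ 0)
    (hs : Summable fun n : ℤ => (q : ℂ) ^ (n ^ 2) * w ^ n) {P : ℝ} (hP : 0 < P)
    (ht : Tendsto (qPoch (q ^ 2)) atTop (𝓝 P)) :
    Tendsto (fun N => ∏ k ∈ Finset.range N,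
        (1 + (q : ℂ) ^ (2 * k + 1) * w) * (1 + (q : ℂ) ^ (2 * k + 1) * w⁻¹)) atTop
      (𝓝 ((P : ℂ)⁻¹ * ∑' n : ℤ, (q : ℂ) ^ (n ^ 2) * w ^ n)) := by
  have hx0 : 0 < q ^ 2 := by positivity
  have hx1 : q ^ 2 < 1 := pow_lt_one₀ h0.le h1 two_ne_zero
  simp only [← (hasSum_finite_triple_product h0 h1 hw _).tsum_eq]
  rw [← tsum_mul_left]
  refine tendsto_tsum_of_dominated_convergence (hs.norm.mul_left (P⁻¹ * P⁻¹)) (fun n => ?_)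
    (Eventually.of_forall fun N n => ?_)
  · refine Tendsto.mul_const _ ?_
    rw [← ofReal_inv]
    refine (continuous_ofReal.tendsto _).comp ?_
    have h2 : Tendsto (fun N : ℕ => 2 * N) atTop atTop :=
      tendsto_atTop_mono (fun N => by simp only [id]; omega) tendsto_id
    have := ((ht.comp h2).mul (tendsto_qPochInv hP ht n)).mul (tendsto_qPochInv hP ht (-n))
    rw [show P * P⁻¹ * P⁻¹ = P⁻¹ by field_simp] at this
    exact this
  · rw [norm_mul]
    refine mul_le_mul_of_nonneg_right ?_ (norm_nonneg _)
    rw [norm_real, Real.norm_eq_abs, tripleCoeff, abs_mul, abs_mul,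
      abs_of_pos (qPoch_pos hx0 hx1 _)]
    have hle : qPoch (q ^ 2) (2 * N) ≤ 1 := by
      simpa [qPoch] using antitone_qPoch hx0 hx1 (Nat.zero_le (2 * N))
    have ha := abs_qPochInv_le hx0 hx1 hP ht (N + n)
    have hb := abs_qPochInv_le hx0 hx1 hP ht (N - n)
    refine mul_le_mul ?_ hb (abs_nonneg _) (by positivity)
    exact (mul_le_of_le_one_left (abs_nonneg _) hle).trans ha

end

/-- Infinite product formula for `jacobiTheta₂` at purely imaginary `τ`, up to the constant. -/
theorem exists_jacobiTheta₂_eq_tprod {τ : ℂ} (hre : τ.re = 0) (him : 0 < τ.im) :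
    ∃ q : ℝ, 0 < q ∧ q < 1 ∧ ∃ P : ℂ, P ≠ 0 ∧ ∀ z, jacobiTheta₂ z τ = P * ∏' k : ℕ,
      (1 + (((q : ℂ) ^ (2 * k + 1)) ^ 2 + (q : ℂ) ^ (2 * k + 1) *
        (cexp (2 * Real.pi * I * z) + (cexp (2 * Real.pi * I * z))⁻¹))) := by
  have h0 : 0 < Real.exp (-(Real.pi * τ.im)) := Real.exp_pos _
  have h1 : Real.exp (-(Real.pi * τ.im)) < 1 :=
    Real.exp_lt_one_iff.2 (neg_lt_zero.2 (mul_pos Real.pi_pos him))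
  obtain ⟨P, hP, ht⟩ := exists_tendsto_qPoch (x := Real.exp (-(Real.pi * τ.im)) ^ 2)
    (by positivity) (pow_lt_one₀ h0.le h1 two_ne_zero)
  refine ⟨_, h0, h1, P, ofReal_ne_zero.2 hP.ne', fun z => ?_⟩
  have hτ : τ = I * τ.im := by
    apply Complex.ext <;> simp [hre]
  have hterm : ∀ n : ℤ, ((Real.exp (-(Real.pi * τ.im)) : ℝ) : ℂ) ^ (n ^ 2) *
      cexp (2 * Real.pi * I * z) ^ n = jacobiTheta₂_term n z τ := fun n => by
    rw [ofReal_exp, ← Complex.exp_int_mul, ← Complex.exp_int_mul, ← Complex.exp_add,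
      jacobiTheta₂_term]
    congr 1
    nth_rewrite 2 [hτ]
    push_cast
    linear_combination -(Real.pi * n ^ 2 * τ.im : ℂ) * I_mul_I
  generalize Real.exp (-(Real.pi * τ.im)) = q at *
  have hs : HasSum (fun n : ℤ => (q : ℂ) ^ (n ^ 2) * cexp (2 * Real.pi * I * z) ^ n)
      (jacobiTheta₂ z τ) := by
    simp only [hterm]; exact hasSum_jacobiTheta₂_term z him
  have hlim := tendsto_triple_product h0 h1 (Complex.exp_ne_zero _) hs.summable hP ht
  rw [hs.tsum_eq] at hlim
  set w := cexp (2 * Real.pi * I * z)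
  have hw : w ≠ 0 := Complex.exp_ne_zero _
  have hsum : Summable fun k : ℕ => ‖((q : ℂ) ^ (2 * k + 1)) ^ 2 + (q : ℂ) ^ (2 * k + 1) *
        (w + w⁻¹)‖ := by
    refine Summable.of_nonneg_of_le (fun _ => norm_nonneg _) (fun k => ?_)
      ((summable_geometric_of_lt_one h0.le h1).mul_right (1 + ‖w + w⁻¹‖))
    have hle : q ^ (2 * k + 1) ≤ q ^ k := pow_le_pow_of_le_one h0.le h1.le (by omega)
    have hle1 : q ^ (2 * k + 1) ≤ 1 := pow_le_one₀ h0.le h1.le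
    have hp : 0 < q ^ (2 * k + 1) := by positivity
    refine (norm_add_le _ _).trans ?_
    rw [norm_mul, norm_pow, norm_pow, norm_real, Real.norm_of_nonneg h0.le]
    nlinarith [norm_nonneg (w + w⁻¹)]
  have hprod := (multipliable_one_add_of_summable hsum).hasProd.tendsto_prod_nat
  -- Each pair of factors is merged into the form `1 + f k` with `f` summable, as required by the
  -- convergence theorems for products.
  have hfac : ∀ k : ℕ, (1 + (q : ℂ) ^ (2 * k + 1) * w) * (1 + (q : ℂ) ^ (2 * k + 1) * w⁻¹) =
      1 + (((q : ℂ) ^ (2 * k + 1)) ^ 2 + (q : ℂ) ^ (2 * k + 1) * (w + w⁻¹)) := fun k => by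
    field_simp; ring
  simp only [hfac] at hlim
  have hPc : (P : ℂ) ≠ 0 := ofReal_ne_zero.2 hP.ne'
  rw [tendsto_nhds_unique hprod hlim, mul_inv_cancel_left₀ hPc]

/-! ### The logarithmic derivative of the theta function -/

theorem im_div_one_add (s : ℂ) : (s / (1 + s)).im = s.im / normSq (1 + s) := by
  rw [div_im]
  simp
  ring

theorem one_add_ne_zero_of_im_ne_zero {s : ℂ} (hs : s.im ≠ 0) : 1 + s ≠ 0 := fun h => by
  have := congrArg im h
  simp at this
  exact hs this

/-- With `w = exp(2πiz)` the factor is `(1 + A w)(1 + A w⁻¹)`, with logarithmic derivative `2πi (Aw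
/ (1 + Aw) - Aw⁻¹ / (1 + Aw⁻¹))`. The imaginary part of `s / (1 + s)` has the sign of `s.im`. As `w`
and `w⁻¹` have imaginary parts of opposite signs, the two contributions add up. -/
theorem neg_im_mul_re_logDeriv_factor_pos {A : ℝ} (hA : 0 < A) {z : ℂ}
    (hz : (cexp (2 * Real.pi * I * z)).im ≠ 0) :
    1 + ((A : ℂ) ^ 2 + A * (cexp (2 * Real.pi * I * z) + (cexp (2 * Real.pi * I * z))⁻¹)) ≠ 0 ∧
    0 < -(cexp (2 * Real.pi * I * z)).im * (logDeriv (fun z => 1 + ((A : ℂ) ^ 2 + A *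
      (cexp (2 * Real.pi * I * z) + (cexp (2 * Real.pi * I * z))⁻¹))) z).re := by
  have hd0 : HasDerivAt (fun z : ℂ => cexp (2 * Real.pi * I * z))
      (cexp (2 * Real.pi * I * z) * (2 * Real.pi * I)) z := by
    simpa using ((hasDerivAt_id z).const_mul (2 * Real.pi * I : ℂ)).cexp
  have hw : cexp (2 * Real.pi * I * z) ≠ 0 := Complex.exp_ne_zero _
  have hd := (((hd0.add (hd0.inv hw)).const_mul (A : ℂ)).const_add ((A : ℂ) ^ 2)).const_add 1
  have hd' : deriv (fun z => 1 + ((A : ℂ) ^ 2 + A *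
      (cexp (2 * Real.pi * I * z) + (cexp (2 * Real.pi * I * z))⁻¹))) z = _ := hd.deriv
  rw [logDeriv_apply, hd']
  generalize cexp (2 * Real.pi * I * z) = w at *
  have h1 : 1 + A * w ≠ 0 := one_add_ne_zero_of_im_ne_zero (by simp [hA.ne', hz])
  have him : (w⁻¹).im = -w.im / normSq w := inv_im w
  have hn : 0 < normSq w := normSq_pos.2 hw
  have h2 : 1 + A * w⁻¹ ≠ 0 := one_add_ne_zero_of_im_ne_zero (by
    rw [im_ofReal_mul, him]
    exact mul_ne_zero hA.ne' (div_ne_zero (neg_ne_zero.2 hz) hn.ne'))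
  have hfac : 1 + ((A : ℂ) ^ 2 + A * (w + w⁻¹)) = (1 + A * w) * (1 + A * w⁻¹) := by
    field_simp; ring
  refine ⟨hfac ▸ mul_ne_zero h1 h2, ?_⟩
  have hq : (A : ℂ) * (w * (2 * Real.pi * I) + -(w * (2 * Real.pi * I)) / w ^ 2) /
      (1 + ((A : ℂ) ^ 2 + A * (w + w⁻¹))) =
      ((2 * Real.pi : ℝ) : ℂ) * (I * (A * w / (1 + A * w) - A * w⁻¹ / (1 + A * w⁻¹))) := by
    rw [hfac, div_sub_div _ _ h1 h2, mul_div_assoc', mul_div_assoc']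
    congr 1
    push_cast
    field_simp
    ring
  rw [hq, re_ofReal_mul, I_mul_re, sub_im, im_div_one_add, im_div_one_add, im_ofReal_mul,
    im_ofReal_mul, him]
  have hn1 := normSq_pos.2 h1
  have hn2 := normSq_pos.2 h2
  have e : -w.im * (2 * Real.pi * -(A * w.im / normSq (1 + A * w) -
      A * (-w.im / normSq w) / normSq (1 + A * w⁻¹))) =
      2 * Real.pi * A * w.im ^ 2 * (1 / normSq (1 + A * w) +
        1 / (normSq w * normSq (1 + A * w⁻¹))) := by
    field_simp
    ring
  rw [e]
  have := Real.pi_pos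
  have : 0 < w.im ^ 2 := by positivity
  positivity

/-- Zeros and logarithmic derivative of the theta function at purely imaginary `τ`. -/
theorem jacobiTheta₂_ne_zero_and_re_pos {τ : ℂ} (hre : τ.re = 0) (him : 0 < τ.im) {z : ℂ}
    (hz : (cexp (2 * Real.pi * I * z)).im ≠ 0) :
    jacobiTheta₂ z τ ≠ 0 ∧ 0 < -(cexp (2 * Real.pi * I * z)).im *
      (logDeriv (fun z => jacobiTheta₂ z τ) z).re := by
  obtain ⟨q, h0, h1, P, hP, hprod⟩ := exists_jacobiTheta₂_eq_tprod hre him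
  set f : ℕ → ℂ → ℂ := fun k z => ((q : ℂ) ^ (2 * k + 1)) ^ 2 + (q : ℂ) ^ (2 * k + 1) *
        (cexp (2 * Real.pi * I * z) + (cexp (2 * Real.pi * I * z))⁻¹) with hf
  have hfac : ∀ k, 1 + f k z ≠ 0 ∧ 0 < -(cexp (2 * Real.pi * I * z)).im *
      (logDeriv (fun z => 1 + f k z) z).re := fun k => by
    have := neg_im_mul_re_logDeriv_factor_pos (A := q ^ (2 * k + 1)) (by positivity) hz
    push_cast at this
    exact this
  have hdiff : ∀ k, Differentiable ℂ (f k) := fun k => by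
    have : Differentiable ℂ fun z : ℂ => cexp (2 * Real.pi * I * z) := by fun_prop
    exact ((this.add (this.inv fun _ => Complex.exp_ne_zero _)).const_mul _).const_add _
  set M := Real.exp (2 * Real.pi * (‖z‖ + 1))
  have hbound : ∀ k, ∀ y ∈ Metric.ball z 1, ‖f k y‖ ≤ q ^ k * (1 + 2 * M) := by
    intro k y hy
    have hy' : ‖y‖ ≤ ‖z‖ + 1 := by
      have := norm_le_norm_add_norm_sub' y z
      rw [mem_ball_iff_norm] at hy
      linarith
    have hM : ∀ v : ℂ, ‖v‖ = ‖y‖ → ‖cexp (2 * Real.pi * I * v)‖ ≤ M := fun v hv => by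
      refine (Complex.norm_exp_le_exp_norm _).trans (Real.exp_le_exp.2 ?_)
      simp only [norm_mul, hv, norm_real, Real.norm_of_nonneg Real.pi_pos.le, norm_I, mul_one,
        Complex.norm_ofNat]
      exact mul_le_mul_of_nonneg_left hy' (by positivity)
    have hM1 := hM y rfl
    have hM2 : ‖(cexp (2 * Real.pi * I * y))⁻¹‖ ≤ M := by
      rw [← Complex.exp_neg, ← mul_neg]
      exact hM (-y) (norm_neg y)
    have hle : q ^ (2 * k + 1) ≤ q ^ k := pow_le_pow_of_le_one h0.le h1.le (by omega)
    have hle1 : q ^ (2 * k + 1) ≤ 1 := pow_le_one₀ h0.le h1.le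
    have hp : 0 < q ^ (2 * k + 1) := by positivity
    refine (norm_add_le _ _).trans ?_
    rw [norm_mul, norm_pow, norm_pow, norm_real, Real.norm_of_nonneg h0.le]
    have := norm_add_le (cexp (2 * Real.pi * I * y)) (cexp (2 * Real.pi * I * y))⁻¹
    have hM0 : 0 < M := Real.exp_pos _
    calc (q ^ (2 * k + 1)) ^ 2 + q ^ (2 * k + 1) * _
        ≤ q ^ (2 * k + 1) + q ^ (2 * k + 1) * (2 * M) :=
          add_le_add (by nlinarith) (mul_le_mul_of_nonneg_left (by linarith) hp.le)
      _ = q ^ (2 * k + 1) * (1 + 2 * M) := by ring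
      _ ≤ _ := mul_le_mul_of_nonneg_right hle (by positivity)
  have hu : Summable fun k : ℕ => q ^ k * (1 + 2 * M) :=
    (summable_geometric_of_lt_one h0.le h1).mul_right _
  have hz1 : z ∈ Metric.ball z 1 := Metric.mem_ball_self one_pos
  have hne : ∏' k, (1 + f k z) ≠ 0 :=
    tprod_one_add_ne_zero_of_summable (fun k => (hfac k).1)
      (hu.of_nonneg_of_le (fun _ => norm_nonneg _) fun k => hbound k z hz1)
  have hunif := hu.hasProdLocallyUniformlyOn_one_add Metric.isOpen_ball
    (Eventually.of_forall hbound) (fun k => (hdiff k).continuous.continuousOn)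
  have htend := logDeriv_tendsto Metric.isOpen_ball hz1 hunif (Eventually.of_forall fun s =>
    (Differentiable.fun_finsetProd fun k _ => (hdiff k).const_add 1).differentiableOn) hne
  have hH : (fun z => jacobiTheta₂ z τ) = fun z => P * ∏' k, (1 + f k z) := funext hprod
  rw [hH, logDeriv_const_mul _ _ hP]
  refine ⟨by rw [hprod]; exact mul_ne_zero hP hne, ?_⟩
  have hlim := ((continuous_re.tendsto _).comp htend).const_mul (-(cexp (2 * Real.pi * I * z)).im)
  -- Limits preserve only weak inequalities; strictness is kept by bounding all partial sums below
  -- by the positive term `k = 0`.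
  refine (hfac 0).2.trans_le (ge_of_tendsto hlim ?_)
  filter_upwards [eventually_ge_atTop {0}] with s hs
  have hs0 : 0 ∈ s := hs (Finset.mem_singleton_self 0)
  rw [Function.comp_apply, logDeriv_prod (fun k _ => (hfac k).1)
    (fun k _ => ((hdiff k).const_add 1) z), re_sum, Finset.mul_sum]
  exact Finset.single_le_sum (f := fun k => -(cexp (2 * Real.pi * I * z)).im *
    (logDeriv (fun z => 1 + f k z) z).re) (fun k _ => (hfac k).2.le) hs0

/-! ### Rectangular lattices -/

/-- The argument of `jacobiTheta₂` that corresponds to the argument `(u + iθ) / (2i)` of `ϑ₁` (with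
`s = τ / 2`) and `ϑ₄` (with `s = 0`). -/
def thetaArg (s : ℂ) (θ : ℝ) (u : ℂ) : ℂ :=
  u / (2 * Real.pi * I) + θ / (2 * Real.pi) + 1 / 2 + s

/-- The second derivative of the potentials of rectangular lattices. -/
def thetaDensity (τ s : ℂ) (θ x : ℝ) : ℝ :=
  (jacobiTheta₂' (thetaArg s θ x) τ / jacobiTheta₂ (thetaArg s θ x) τ).re / Real.pi

/-- The shift `1 / 2` gives the factor `-1`, while `x` and the imaginary `s` only scale by a
positive real; the sign is therefore governed by `sin θ`. -/
theorem im_exp_thetaArg {s : ℂ} (hs : s.re = 0) (θ x : ℝ) :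
    (cexp (2 * Real.pi * I * thetaArg s θ x)).im =
      -(Real.exp (x - 2 * Real.pi * s.im) * Real.sin θ) := by
  have hpi : (Real.pi : ℂ) ≠ 0 := ofReal_ne_zero.2 Real.pi_ne_zero
  have hs' : s = I * s.im := by apply Complex.ext <;> simp [hs]
  have : 2 * Real.pi * I * thetaArg s θ x =
      ((x - 2 * Real.pi * s.im : ℝ) : ℂ) + θ * I + Real.pi * I := by
    rw [thetaArg, hs']
    push_cast
    field_simp
    simp only [im_mul_ofReal, I_im, one_mul]
    linear_combination (2 * Real.pi * s.im : ℂ) * I_mul_I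
  rw [this, Complex.exp_add, Complex.exp_add, Complex.exp_pi_mul_I, ← ofReal_exp, mul_neg_one,
    neg_im, im_ofReal_mul, Complex.exp_ofReal_mul_I_im]

/-- As theta is even and 1-periodic, and commutes with conjugation for imaginary `τ`, this makes the
denominator of the quotient the conjugate of its numerator. -/
theorem thetaArg_neg {s : ℂ} (hs : s.re = 0) (θ x : ℝ) :
    thetaArg s (-θ) x = -conj (thetaArg s θ x) + 1 := by
  have hs' : conj s = -s := by apply Complex.ext <;> simp [hs]
  have h2 : conj (2 : ℂ) = 2 := map_ofNat _ 2
  simp only [thetaArg, map_add, map_div₀, map_mul, conj_ofReal, conj_I, h2, map_one, hs']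
  push_cast
  rw [mul_neg, div_neg]
  ring

section

variable {τ s : ℂ} {θ : ℝ}

theorem theta_ne_zero (hre : τ.re = 0) (him : 0 < τ.im) (hs : s.re = 0) (hθ : Real.sin θ ≠ 0)
    (x : ℝ) : jacobiTheta₂ (thetaArg s θ x) τ ≠ 0 :=
  (jacobiTheta₂_ne_zero_and_re_pos hre him (by
    rw [im_exp_thetaArg hs]
    exact neg_ne_zero.2 (mul_ne_zero (Real.exp_pos _).ne' hθ))).1

theorem sin_mul_thetaDensity_pos (hre : τ.re = 0) (him : 0 < τ.im) (hs : s.re = 0)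
    (hθ : Real.sin θ ≠ 0) (x : ℝ) : 0 < Real.sin θ * thetaDensity τ s θ x := by
  have h := (jacobiTheta₂_ne_zero_and_re_pos hre him (z := thetaArg s θ x) (by
    rw [im_exp_thetaArg hs]
    exact neg_ne_zero.2 (mul_ne_zero (Real.exp_pos _).ne' hθ))).2
  rw [im_exp_thetaArg hs, neg_neg, mul_assoc, logDeriv_apply,
    (hasDerivAt_jacobiTheta₂_fst _ him).deriv] at h
  rw [thetaDensity, ← mul_div_assoc]
  exact div_pos (pos_of_mul_pos_right h (Real.exp_pos _).le) Real.pi_pos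

theorem continuous_thetaDensity (hre : τ.re = 0) (him : 0 < τ.im) (hs : s.re = 0)
    (hθ : Real.sin θ ≠ 0) : Continuous (thetaDensity τ s θ) := by
  have ha : Continuous fun x : ℝ => thetaArg s θ x := by unfold thetaArg; fun_prop
  have h1 : Continuous fun z => jacobiTheta₂' z τ := continuous_iff_continuousAt.2 fun z =>
    ContinuousAt.comp (f := fun z => (z, τ)) (continuousAt_jacobiTheta₂' z him) (by fun_prop)
  have h2 : Continuous fun z => jacobiTheta₂ z τ := continuous_iff_continuousAt.2 fun z =>
    (differentiableAt_jacobiTheta₂_fst z him).continuousAt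
  exact (continuous_re.comp ((h1.comp ha).div (h2.comp ha)
    (theta_ne_zero hre him hs hθ))).div_const _

/-- The translation moves the theta argument by `τ`, which adds `-2πi` to the logarithmic
derivative; the real part does not see it. -/
theorem periodic_thetaDensity (hre : τ.re = 0) (him : 0 < τ.im) (hs : s.re = 0)
    (hθ : Real.sin θ ≠ 0) : Function.Periodic (thetaDensity τ s θ) (-(2 * Real.pi * τ.im)) := by
  intro x
  have hpi : (Real.pi : ℂ) ≠ 0 := ofReal_ne_zero.2 Real.pi_ne_zero
  have hτ : τ = I * τ.im := by apply Complex.ext <;> simp [hre]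
  have ha : thetaArg s θ (x + -(2 * Real.pi * τ.im) : ℝ) = thetaArg s θ x + τ := by
    rw [thetaArg, thetaArg]
    nth_rewrite 2 [hτ]
    push_cast
    field_simp
    linear_combination (-2 * Real.pi * τ.im : ℂ) * I_mul_I
  have h0 := theta_ne_zero hre him hs hθ x
  rw [thetaDensity, thetaDensity, ha, jacobiTheta₂_add_left', jacobiTheta₂'_add_left',
    mul_div_mul_left _ _ (Complex.exp_ne_zero _), sub_div, mul_div_cancel_right₀ _ h0]
  simp

/-- Conjugate symmetry turns the difference of the logarithmic derivatives into twice a real part,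
divided by `2πi`. The constant `c` drops out; it absorbs the prefactor of `ϑ₁`. -/
theorem logDeriv_theta_ratio (hre : τ.re = 0) (him : 0 < τ.im) (hs : s.re = 0)
    (hθ : Real.sin θ ≠ 0) {c : ℂ} (hc : c ≠ 0) {q : ℂ → ℂ}
    (hq : ∀ u, q u = c * (jacobiTheta₂ (thetaArg s θ u) τ / jacobiTheta₂ (thetaArg s (-θ) u) τ))
    (x : ℝ) : deriv q x / q x = I * (-thetaDensity τ s θ x : ℝ) := by
  have hpi : (Real.pi : ℂ) ≠ 0 := ofReal_ne_zero.2 Real.pi_ne_zero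
  have hτ : -conj τ = τ := by apply Complex.ext <;> simp [hre]
  have h1 := theta_ne_zero hre him hs hθ x
  have h2 := theta_ne_zero hre him hs (θ := -θ) (by simpa using hθ) x
  have hd : ∀ t : ℝ, HasDerivAt (fun u => jacobiTheta₂ (thetaArg s t u) τ)
      (jacobiTheta₂' (thetaArg s t x) τ * (1 / (2 * Real.pi * I))) x := fun t => by
    have : HasDerivAt (thetaArg s t) (1 / (2 * Real.pi * I)) (x : ℂ) :=
      ((((hasDerivAt_id (x : ℂ)).div_const _).add_const _).add_const _).add_const _
    exact (hasDerivAt_jacobiTheta₂_fst _ him).comp (x : ℂ) this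
  have hqf : q = fun u => c * ((fun u => jacobiTheta₂ (thetaArg s θ u) τ) u /
      (fun u => jacobiTheta₂ (thetaArg s (-θ) u) τ) u) := funext hq
  rw [← logDeriv_apply, hqf, logDeriv_const_mul _ _ hc,
    logDeriv_div (f := fun u => jacobiTheta₂ (thetaArg s θ u) τ)
      (g := fun u => jacobiTheta₂ (thetaArg s (-θ) u) τ) _ h1 h2 (hd θ).differentiableAt (hd (-θ)).differentiableAt, logDeriv_apply,
    logDeriv_apply, (hd θ).deriv, (hd (-θ)).deriv]
  have e1 : jacobiTheta₂ (thetaArg s (-θ) x) τ = conj (jacobiTheta₂ (thetaArg s θ x) τ) := by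
    rw [thetaArg_neg hs, jacobiTheta₂_add_left, jacobiTheta₂_neg_left, jacobiTheta₂_conj, hτ]
  have e2 : jacobiTheta₂' (thetaArg s (-θ) x) τ = -conj (jacobiTheta₂' (thetaArg s θ x) τ) := by
    rw [thetaArg_neg hs, jacobiTheta₂'_add_left, jacobiTheta₂'_neg_left, jacobiTheta₂'_conj, hτ]
  have e3 : ((thetaDensity τ s θ x : ℝ) : ℂ) =
      (jacobiTheta₂' (thetaArg s θ x) τ / jacobiTheta₂ (thetaArg s θ x) τ +
        conj (jacobiTheta₂' (thetaArg s θ x) τ / jacobiTheta₂ (thetaArg s θ x) τ)) /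
        (2 * Real.pi) := by
    rw [add_conj, thetaDensity]
    push_cast
    field_simp
  rw [ofReal_neg, e3, map_div₀]
  simp only [e1, e2]
  have h3 : conj (jacobiTheta₂ (thetaArg s θ x) τ) ≠ 0 := e1 ▸ h2
  generalize conj (jacobiTheta₂ (thetaArg s θ x) τ) = a at *
  generalize conj (jacobiTheta₂' (thetaArg s θ x) τ) = b at *
  generalize jacobiTheta₂ (thetaArg s θ x) τ = a' at *
  generalize jacobiTheta₂' (thetaArg s θ x) τ = b' at *
  field_simp
  rw [I_sq]
  ring

end

theorem rectPotential_eq {τ : ℂ} (hre : τ.re = 0) (him : 0 < τ.im) {θ : ℝ}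
    (hθ : Real.sin θ ≠ 0) (Z : ℝ) : rectPotential τ θ Z =
      doubleIntegral (fun x => thetaDensity τ (τ / 2) θ x + thetaDensity τ 0 θ x) Z := by
  have hpi : (Real.pi : ℂ) ≠ 0 := ofReal_ne_zero.2 Real.pi_ne_zero
  have hs : (τ / 2).re = 0 := by simp [hre]
  have hc1 := continuous_thetaDensity hre him hs hθ
  have hc2 := continuous_thetaDensity hre him zero_re hθ
  have ha : ∀ u, (u + I * θ) / (2 * I) / Real.pi + 1 / 2 = thetaArg 0 θ u := fun u => by
    rw [thetaArg]; field_simp; ring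
  have hb : ∀ u, (u - I * θ) / (2 * I) / Real.pi + 1 / 2 = thetaArg 0 (-θ) u := fun u => by
    rw [thetaArg]; push_cast; field_simp; ring
  have ha' : ∀ u, (u + I * θ) / (2 * I) / Real.pi + 1 / 2 + τ / 2 = thetaArg (τ / 2) θ u :=
    fun u => by rw [ha, thetaArg, thetaArg, add_zero]
  have hb' : ∀ u, (u - I * θ) / (2 * I) / Real.pi + 1 / 2 + τ / 2 = thetaArg (τ / 2) (-θ) u :=
    fun u => by rw [hb, thetaArg, thetaArg, add_zero]
  have h1 := logDeriv_theta_ratio hre him hs hθ (neg_ne_zero.2 (Complex.exp_ne_zero (I * θ)))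
    (q := fun u => -(theta1 τ ((u + I * θ) / (2 * I)) / theta1 τ ((u - I * θ) / (2 * I))))
    fun u => by
      -- The exponential prefactors of `ϑ₁` have the quotient `exp(iθ)`, independent of `u`.
      have he : cexp (I * Real.pi * τ / 4 + I * ((u + I * θ) / (2 * I))) =
          cexp (I * θ) * cexp (I * Real.pi * τ / 4 + I * ((u - I * θ) / (2 * I))) := by
        rw [← Complex.exp_add]
        congr 1
        field_simp
        ring
      rw [theta1_eq him, theta1_eq him, ha', hb', he, mul_div_mul_comm,
        mul_div_mul_left _ _ (neg_ne_zero.2 I_ne_zero),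
        mul_div_cancel_right₀ _ (Complex.exp_ne_zero _), neg_mul]
  have h2 := logDeriv_theta_ratio hre him zero_re hθ one_ne_zero
    (q := fun u => theta4 τ ((u + I * θ) / (2 * I)) / theta4 τ ((u - I * θ) / (2 * I)))
    fun u => by rw [theta4_eq him, theta4_eq him, ha, hb, one_mul]
  rw [rectPotential, logIntegral_eq h1, logIntegral_eq h2, ← ofReal_add]
  congr 1
  simp only [doubleIntegral, neg_neg]
  rw [← intervalIntegral.integral_add ((continuous_integral hc1).intervalIntegrable _ _)
    ((continuous_integral hc2).intervalIntegrable _ _)]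
  congr 1
  ext u
  rw [intervalIntegral.integral_add (hc1.intervalIntegrable _ _) (hc2.intervalIntegrable _ _)]

theorem exp_mem_upperCircle_iff (θ : ℝ) : cexp (I * θ) ∈ upperCircle ↔ 0 < Real.sin θ := by
  rw [mul_comm, upperCircle, mem_ofPred_eq, norm_exp_ofReal_mul_I, exp_ofReal_mul_I_im]
  simp

theorem exp_mem_lowerCircle_iff (θ : ℝ) : cexp (I * θ) ∈ lowerCircle ↔ Real.sin θ < 0 := by
  rw [mul_comm, lowerCircle, mem_ofPred_eq, norm_exp_ofReal_mul_I, exp_ofReal_mul_I_im]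
  simp

theorem dirichletUniquelySolvable_rect {V E : Type*} [Fintype V] [Nontrivial V] [Fintype E]
    {src tgt : E → V} (hconn : IsConnected src tgt) {θ : E → ℝ} (Θ : V → ℝ) (B : Set V)
    (b : V → ℝ) {τ : ℂ} (hre : τ.re = 0) (him : 0 < τ.im) (hθ : RectConvexLabels θ) :
    DirichletUniquelySolvable (action src tgt (rectPotential τ) θ Θ) B b := by
  simp only [RectConvexLabels, exp_mem_upperCircle_iff, exp_mem_lowerCircle_iff] at hθ
  have hsin : ∀ e, Real.sin (θ e) ≠ 0 := fun e => by
    rcases hθ with h | h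
    · exact (h e).ne'
    · exact (h e).ne
  have hs : (τ / 2).re = 0 := by simp [hre]
  have hpos1 := fun e => sin_mul_thetaDensity_pos hre him hs (hsin e)
  have hpos2 := fun e => sin_mul_thetaDensity_pos hre him zero_re (hsin e)
  refine dirichletUniquelySolvable_of_periodic hconn Θ B b
    (g := fun e x => thetaDensity τ (τ / 2) (θ e) x + thetaDensity τ 0 (θ e) x)
    (T := -(2 * Real.pi * τ.im))
    (fun e => (continuous_thetaDensity hre him hs (hsin e)).add
      (continuous_thetaDensity hre him zero_re (hsin e)))
    (fun e Z => rectPotential_eq hre him (hsin e) Z)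
    (neg_ne_zero.2 (mul_pos Real.two_pi_pos him).ne')
    (fun e => (periodic_thetaDensity hre him hs (hsin e)).add
      (periodic_thetaDensity hre him zero_re (hsin e))) ?_
  refine hθ.imp (fun h e Z => ?_) (fun h e Z => ?_)
  · exact add_pos (pos_of_mul_pos_right (hpos1 e Z) (h e).le)
      (pos_of_mul_pos_right (hpos2 e Z) (h e).le)
  · exact add_neg (by nlinarith [hpos1 e Z, h e]) (by nlinarith [hpos2 e Z, h e])

/-! ### The Weierstrass sigma function -/

theorem deriv_logDeriv {g : ℂ → ℂ} {U : Set ℂ} (hU : IsOpen U) (hg : DifferentiableOn ℂ g U)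
    {u : ℂ} (hu : u ∈ U) (h0 : g u ≠ 0) :
    deriv (logDeriv g) u = (deriv (deriv g) u * g u - deriv g u * deriv g u) / g u ^ 2 :=
  deriv_div ((hg.deriv hU).differentiableAt (hU.mem_nhds hu)) (hg.differentiableAt (hU.mem_nhds hu))
    h0

/-- Locally uniform limits of holomorphic functions may be differentiated twice; used to compute
`ζ'` from the partial products of `σ`. -/
theorem tendsto_deriv_logDeriv {ι : Type*} {p : Filter ι} {F : ι → ℂ → ℂ} {f : ℂ → ℂ} {U : Set ℂ}
    (hU : IsOpen U) (hF : TendstoLocallyUniformlyOn F f p U) [p.NeBot]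
    (hd : ∀ n, DifferentiableOn ℂ (F n) U) {u : ℂ} (hu : u ∈ U) (hF0 : ∀ n, F n u ≠ 0)
    (hf0 : f u ≠ 0) :
    Tendsto (fun n => deriv (logDeriv (F n)) u) p (𝓝 (deriv (logDeriv f) u)) := by
  have h1 := hF.deriv (Eventually.of_forall hd) hU
  have h2 := h1.deriv (Eventually.of_forall fun n => (hd n).deriv hU) hU
  rw [deriv_logDeriv hU (hF.differentiableOn (Eventually.of_forall hd) hU) hu hf0]
  simp only [deriv_logDeriv hU (hd _) hu (hF0 _)]
  exact (((h2.tendsto_at hu).mul (hF.tendsto_at hu)).sub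
    ((h1.tendsto_at hu).mul (h1.tendsto_at hu))).div ((hF.tendsto_at hu).pow 2) (pow_ne_zero 2 hf0)

/-- The elementary factor `(1 - u/w) exp(u/w + u²/(2w²))`. -/
def sigmaFactor (w u : ℂ) : ℂ := (1 - u / w) * cexp (u / w + u ^ 2 / (2 * w ^ 2))

theorem hasDerivAt_sigmaFactor (w u : ℂ) (hw : w ≠ 0) :
    HasDerivAt (sigmaFactor w) (-(u / w) ^ 2 / w * cexp (u / w + u ^ 2 / (2 * w ^ 2))) u := by
  have h1 : HasDerivAt (fun u : ℂ => 1 - u / w) (-(1 / w)) u :=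
    ((hasDerivAt_id u).div_const w).const_sub 1
  have h2 : HasDerivAt (fun u : ℂ => cexp (u / w + u ^ 2 / (2 * w ^ 2)))
      (cexp (u / w + u ^ 2 / (2 * w ^ 2)) * (1 / w + 2 * u / (2 * w ^ 2))) u := by
    have := (((hasDerivAt_id u).div_const w).add
      (((hasDerivAt_id u).pow 2).div_const (2 * w ^ 2))).cexp
    simpa using this
  convert! h1.mul h2 using 1
  field_simp
  ring

theorem differentiable_sigmaFactor {w : ℂ} (hw : w ≠ 0) : Differentiable ℂ (sigmaFactor w) :=
  fun u => (hasDerivAt_sigmaFactor w u hw).differentiableAt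

theorem sigmaFactor_ne_zero {w u : ℂ} (hw : w ≠ 0) (hu : u ≠ w) : sigmaFactor w u ≠ 0 :=
  mul_ne_zero (sub_ne_zero.2 fun h => hu ((div_eq_one_iff_eq hw).1 h.symm)) (Complex.exp_ne_zero _)

theorem logDeriv_sigmaFactor {w u : ℂ} (hw : w ≠ 0) (hu : u ≠ w) :
    logDeriv (sigmaFactor w) u = 1 / (u - w) + u / w ^ 2 + 1 / w := by
  have h1 : u - w ≠ 0 := sub_ne_zero.2 hu
  have h2 : 1 - u / w ≠ 0 := sub_ne_zero.2 fun h => hu ((div_eq_one_iff_eq hw).1 h.symm)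
  have h3 : w - u ≠ 0 := sub_ne_zero.2 hu.symm
  rw [logDeriv_apply, (hasDerivAt_sigmaFactor w u hw).deriv, sigmaFactor,
    mul_div_mul_right _ _ (Complex.exp_ne_zero _)]
  have h4 : 1 - u / w = (w - u) / w := by field_simp
  have h5 : u - w = -(w - u) := by ring
  rw [h4, h5]
  field_simp
  ring

/-- The derivative of the factor vanishes to second order at `0`, so the mean value inequality gives
cubic decay in `u / w`. The exponent has norm at most `1 + 1 / 2 ≤ 2`. -/
theorem norm_sigmaFactor_sub_one_le {w u : ℂ} (hw : w ≠ 0) (hu : ‖u‖ ≤ ‖w‖) :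
    ‖sigmaFactor w u - 1‖ ≤ ‖u‖ ^ 3 * Real.exp 2 * (‖w‖ ^ 3)⁻¹ := by
  have hw' : 0 < ‖w‖ := norm_pos_iff.2 hw
  have hbound : ∀ v ∈ Metric.closedBall (0 : ℂ) ‖u‖,
      ‖-(v / w) ^ 2 / w * cexp (v / w + v ^ 2 / (2 * w ^ 2))‖ ≤
        (‖u‖ / ‖w‖) ^ 2 / ‖w‖ * Real.exp 2 := fun v hv => by
    have hv' : ‖v‖ ≤ ‖u‖ := mem_closedBall_zero_iff.1 hv
    rw [norm_mul, norm_div, norm_neg, norm_pow, norm_div]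
    refine mul_le_mul (by gcongr) ((Complex.norm_exp_le_exp_norm _).trans (Real.exp_le_exp.2 ?_))
      (norm_nonneg _) (by positivity)
    have h1 : ‖v / w‖ ≤ 1 := by rw [norm_div]; exact div_le_one_of_le₀ (hv'.trans hu) hw'.le
    have h2 : v ^ 2 / (2 * w ^ 2) = 1 / 2 * (v / w) ^ 2 := by field_simp
    refine (norm_add_le _ _).trans ?_
    rw [h2, norm_mul, norm_pow]
    have : ‖(1 / 2 : ℂ)‖ = 1 / 2 := by simp
    rw [this]
    nlinarith [norm_nonneg (v / w)]
  have := (convex_closedBall (0 : ℂ) ‖u‖).norm_image_sub_le_of_norm_hasDerivWithin_le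
    (fun v _ => (hasDerivAt_sigmaFactor w v hw).hasDerivWithinAt) hbound
    (x := 0) (y := u) (by simp) (by simp)
  have h0 : sigmaFactor w 0 = 1 := by simp [sigmaFactor]
  rw [h0, sub_zero] at this
  refine this.trans (le_of_eq ?_)
  field_simp

/-- The nonzero elements of a lattice. -/
abbrev NonzeroLattice (L : PeriodPair) : Type := {w : L.lattice // w ≠ 0}

/-- The infinite product in the definition of `σ`. -/
def sigmaProd (L : PeriodPair) (u : ℂ) : ℂ :=
  ∏' w : NonzeroLattice L, (1 + (sigmaFactor (w : L.lattice) u - 1))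

theorem weierstrassSigma_eq (L : PeriodPair) (u : ℂ) :
    weierstrassSigma L u = u * sigmaProd L u := by
  simp only [sigmaProd, add_sub_cancel]
  rfl

section

variable {L : PeriodPair}

theorem NonzeroLattice.coe_ne_zero (w : NonzeroLattice L) : ((w : L.lattice) : ℂ) ≠ 0 :=
  fun h => w.2 (Subtype.ext h)

theorem summable_nonzeroLattice (c : ℝ) :
    Summable fun w : NonzeroLattice L => c * (‖((w : L.lattice) : ℂ)‖ ^ 3)⁻¹ := by
  -- The exponent `-3` lies below minus the rank `2` of the lattice.
  have h := ZLattice.summable_norm_rpow L.lattice (-3) (by simp; norm_num)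
  have h' := (h.subtype {w : L.lattice | w ≠ 0}).mul_left c
  refine h'.congr fun w => ?_
  simp only [Function.comp_apply]
  congr 1
  rw [Real.rpow_neg (norm_nonneg _)]
  norm_cast

theorem eventually_norm_sigmaFactor_le (r : ℝ) :
    ∀ᶠ w : NonzeroLattice L in cofinite, ∀ u ∈ Metric.ball (0 : ℂ) r,
      ‖sigmaFactor (w : L.lattice) u - 1‖ ≤
        r ^ 3 * Real.exp 2 * (‖((w : L.lattice) : ℂ)‖ ^ 3)⁻¹ := by
  have hfin : {w : NonzeroLattice L | ‖((w : L.lattice) : ℂ)‖ ≤ r}.Finite := by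
    have := isCompact_iff_finite.1 (isCompact_closedBall (0 : L.lattice) r)
    refine (this.preimage Subtype.val_injective.injOn).subset fun w hw => ?_
    simpa using hw
  filter_upwards [hfin.compl_mem_cofinite] with w hw u hu
  have hw' : r < ‖((w : L.lattice) : ℂ)‖ := not_le.1 hw
  have hu' : ‖u‖ ≤ r := (mem_ball_zero_iff.1 hu).le
  refine (norm_sigmaFactor_sub_one_le w.coe_ne_zero (hu'.trans hw'.le)).trans ?_
  gcongr

theorem tendstoLocallyUniformlyOn_sigmaProd (r : ℝ) :
    TendstoLocallyUniformlyOn (fun (s : Finset (NonzeroLattice L)) u =>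
      ∏ w ∈ s, (1 + (sigmaFactor (w : L.lattice) u - 1))) (sigmaProd L) atTop
      (Metric.ball (0 : ℂ) r) :=
  hasProdLocallyUniformlyOn_iff_tendstoLocallyUniformlyOn.1 <|
    (summable_nonzeroLattice _).hasProdLocallyUniformlyOn_one_add Metric.isOpen_ball
      (eventually_norm_sigmaFactor_le r) fun w =>
        ((differentiable_sigmaFactor w.coe_ne_zero).continuous.sub continuous_const).continuousOn

theorem summable_norm_sigmaFactor (u : ℂ) :
    Summable fun w : NonzeroLattice L => ‖sigmaFactor (w : L.lattice) u - 1‖ := by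
  refine (summable_nonzeroLattice ((‖u‖ + 1) ^ 3 * Real.exp 2)).of_norm_bounded_eventually ?_
  filter_upwards [eventually_norm_sigmaFactor_le (‖u‖ + 1)] with w hw
  rw [norm_norm]
  exact hw u (by simp)

theorem differentiable_partialProd (s : Finset (NonzeroLattice L)) :
    Differentiable ℂ fun u => ∏ w ∈ s, (1 + (sigmaFactor (w : L.lattice) u - 1)) :=
  Differentiable.fun_finsetProd fun w _ =>
    ((differentiable_sigmaFactor w.coe_ne_zero).sub_const 1).const_add 1

theorem differentiable_sigmaProd : Differentiable ℂ (sigmaProd L) := fun u =>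
  ((tendstoLocallyUniformlyOn_sigmaProd (‖u‖ + 1)).differentiableOn
    (Eventually.of_forall fun s => (differentiable_partialProd s).differentiableOn)
    Metric.isOpen_ball).differentiableAt (Metric.isOpen_ball.mem_nhds (by simp))

theorem ne_of_notMem_lattice {u : ℂ} (hu : u ∉ L.lattice) (w : NonzeroLattice L) :
    u ≠ (w : L.lattice) := fun h => hu (h ▸ (w : L.lattice).2)

theorem sigmaProd_ne_zero {u : ℂ} (hu : u ∉ L.lattice) : sigmaProd L u ≠ 0 :=
  tprod_one_add_ne_zero_of_summable (fun w => by
    rw [add_sub_cancel]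
    exact sigmaFactor_ne_zero w.coe_ne_zero (ne_of_notMem_lattice hu w))
    (summable_norm_sigmaFactor u)

theorem differentiable_weierstrassSigma : Differentiable ℂ (weierstrassSigma L) := by
  rw [funext (weierstrassSigma_eq L)]
  exact differentiable_id.mul differentiable_sigmaProd

theorem weierstrassSigma_ne_zero {u : ℂ} (hu : u ∉ L.lattice) : weierstrassSigma L u ≠ 0 := by
  rw [weierstrassSigma_eq]
  exact mul_ne_zero (fun h => hu (h ▸ L.lattice.zero_mem)) (sigmaProd_ne_zero hu)

theorem hasSum_sigmaProd_terms (u : ℂ) :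
    HasSum (fun w : NonzeroLattice L => 1 / (u - (w : L.lattice)) ^ 2 - 1 / (w : L.lattice) ^ 2)
      (L.weierstrassPExcept 0 u) := by
  refine (hasSum_subtype_iff_indicator (s := {w : L.lattice | w ≠ 0})
    (f := fun w : L.lattice => 1 / (u - (w : ℂ)) ^ 2 - 1 / (w : ℂ) ^ 2)).2 ?_
  convert! L.hasSum_weierstrassPExcept 0 u using 1
  ext w
  by_cases h : w = 0 <;> simp [Set.indicator, h]

theorem deriv_logDeriv_partialProd {u : ℂ} (hu : u ∉ L.lattice) (s : Finset (NonzeroLattice L)) :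
    deriv (logDeriv fun u => ∏ w ∈ s, (1 + (sigmaFactor (w : L.lattice) u - 1))) u =
      -∑ w ∈ s, (1 / (u - (w : L.lattice)) ^ 2 - 1 / (w : L.lattice) ^ 2) := by
  have hopen : IsOpen (L.lattice : Set ℂ)ᶜ := L.isClosed_lattice.isOpen_compl
  have hev : (logDeriv fun u => ∏ w ∈ s, (1 + (sigmaFactor (w : L.lattice) u - 1))) =ᶠ[𝓝 u]
      fun v => ∑ w ∈ s, (1 / (v - (w : L.lattice)) + v / (w : L.lattice) ^ 2 +
        1 / (w : L.lattice)) := by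
    filter_upwards [hopen.mem_nhds hu] with v hv
    simp only [add_sub_cancel]
    rw [logDeriv_prod (f := fun (w : NonzeroLattice L) u => sigmaFactor (w : L.lattice) u)
      (fun w _ => sigmaFactor_ne_zero w.coe_ne_zero (ne_of_notMem_lattice hv w))
      (fun w _ => differentiable_sigmaFactor w.coe_ne_zero v)]
    exact Finset.sum_congr rfl fun w _ =>
      logDeriv_sigmaFactor w.coe_ne_zero (ne_of_notMem_lattice hv w)
  rw [hev.deriv_eq, ← Finset.sum_neg_distrib]
  refine HasDerivAt.deriv (HasDerivAt.fun_sum fun w _ => ?_)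
  have hne : u - (w : L.lattice) ≠ 0 := sub_ne_zero.2 (ne_of_notMem_lattice hu w)
  have h1 := ((hasDerivAt_id u).sub_const ((w : L.lattice) : ℂ)).inv hne
  have h2 := (hasDerivAt_id u).div_const (((w : L.lattice) : ℂ) ^ 2)
  have h3 := (h1.add h2).add_const (1 / ((w : L.lattice) : ℂ))
  convert! h3 using 1
  · ext v; simp
  · simp; ring

theorem hasDerivAt_logDeriv_sigmaProd {u : ℂ} (hu : u ∉ L.lattice) :
    HasDerivAt (logDeriv (sigmaProd L)) (-L.weierstrassPExcept 0 u) u := by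
  have hd : DifferentiableAt ℂ (logDeriv (sigmaProd L)) u :=
    (differentiable_sigmaProd.analyticAt u).deriv.differentiableAt.div
      differentiable_sigmaProd.differentiableAt (sigmaProd_ne_zero hu)
  have hlim := tendsto_deriv_logDeriv Metric.isOpen_ball
    (tendstoLocallyUniformlyOn_sigmaProd (L := L) (‖u‖ + 1))
    (fun s => (differentiable_partialProd s).differentiableOn) (u := u) (by simp)
    (fun s => Finset.prod_ne_zero_iff.2 fun w _ => by
      rw [add_sub_cancel]
      exact sigmaFactor_ne_zero w.coe_ne_zero (ne_of_notMem_lattice hu w)) (sigmaProd_ne_zero hu)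
  simp only [deriv_logDeriv_partialProd hu] at hlim
  have h2 : Tendsto (fun s : Finset (NonzeroLattice L) => ∑ w ∈ s, (1 / (u - (w : L.lattice)) ^ 2 -
      1 / (w : L.lattice) ^ 2)) atTop (𝓝 (L.weierstrassPExcept 0 u)) := hasSum_sigmaProd_terms u
  rw [← tendsto_nhds_unique hlim h2.neg]
  exact hd.hasDerivAt

/-- The factor `u` of `σ` contributes `1 / u` to `ζ`, whose derivative supplies exactly the term of
the origin missing from `weierstrassPExcept 0`. -/
theorem hasDerivAt_weierstrassZeta {u : ℂ} (hu : u ∉ L.lattice) :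
    HasDerivAt (weierstrassZeta L) (-L.weierstrassP u) u := by
  have hu0 : u ≠ 0 := fun h => hu (h ▸ L.lattice.zero_mem)
  have hopen : IsOpen (L.lattice : Set ℂ)ᶜ := L.isClosed_lattice.isOpen_compl
  have hev : weierstrassZeta L =ᶠ[𝓝 u] fun v => v⁻¹ + logDeriv (sigmaProd L) v := by
    filter_upwards [hopen.mem_nhds hu] with v hv
    have hv0 : v ≠ 0 := fun h => hv (h ▸ L.lattice.zero_mem)
    rw [weierstrassZeta, ← logDeriv_apply, funext (weierstrassSigma_eq L),
      logDeriv_mul v hv0 (sigmaProd_ne_zero hv) differentiableAt_fun_id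
        differentiable_sigmaProd.differentiableAt, logDeriv_id', one_div]
  refine HasDerivAt.congr_of_eventuallyEq ?_ hev
  convert! (hasDerivAt_inv hu0).add (hasDerivAt_logDeriv_sigmaProd hu) using 1
  have := L.weierstrassPExcept_add 0 u
  simp only [ZeroMemClass.coe_zero, sub_zero] at this
  rw [← this]
  simp

theorem weierstrassSigma_neg (u : ℂ) : weierstrassSigma L (-u) = -weierstrassSigma L u := by
  let e : NonzeroLattice L ≃ NonzeroLattice L :=
    (Equiv.neg L.lattice).subtypeEquiv fun w => by simp
  rw [weierstrassSigma, weierstrassSigma, ← e.tprod_eq, neg_mul]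
  congr 3
  ext w
  simp [e, neg_div_neg_eq]

theorem weierstrassZeta_neg (u : ℂ) : weierstrassZeta L (-u) = -weierstrassZeta L u := by
  have h := deriv_comp_neg (weierstrassSigma L) u
  rw [funext (weierstrassSigma_neg (L := L)), deriv.fun_neg, neg_inj] at h
  rw [weierstrassZeta, weierstrassZeta, weierstrassSigma_neg, ← h, div_neg]

end

/-! ### Rhombic lattices -/

section

variable {L : PeriodPair}

/-- A real sum forces opposite imaginary parts; equal moduli then force real parts equal up to sign,
and the positive sum excludes opposite ones. -/
theorem IsRhombic.conj_ω₁ (h : IsRhombic L) : conj L.ω₁ = L.ω₂ := by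
  have h0 : L.ω₁ ≠ 0 := fun h0 => by simpa [h0] using h.norm_ratio
  have h1 : ‖L.ω₂‖ = ‖L.ω₁‖ := by
    have := h.norm_ratio
    rwa [norm_div, div_eq_one_iff_eq (norm_ne_zero_iff.2 h0)] at this
  have h2 : L.ω₂.re * L.ω₂.re + L.ω₂.im * L.ω₂.im = L.ω₁.re * L.ω₁.re + L.ω₁.im * L.ω₁.im := by
    rw [← normSq_apply, ← normSq_apply, normSq_eq_norm_sq, normSq_eq_norm_sq, h1]
  have h3 := h.sum_im
  have h4 := h.sum_re
  rw [add_im] at h3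
  rw [add_re] at h4
  have h5 : L.ω₂.im = -L.ω₁.im := by linarith
  rw [h5] at h2
  have h6 : (L.ω₁.re - L.ω₂.re) * (L.ω₁.re + L.ω₂.re) = 0 := by linarith
  have h7 := (mul_eq_zero.1 h6).resolve_right h4.ne'
  apply Complex.ext
  · rw [conj_re]; linarith
  · rw [conj_im, h5]

theorem IsRhombic.conj_mem (h : IsRhombic L) {w : ℂ} (hw : w ∈ L.lattice) :
    conj w ∈ L.lattice := by
  obtain ⟨m, n, rfl⟩ := PeriodPair.mem_lattice.1 hw
  have h2 : conj L.ω₂ = L.ω₁ := by rw [← h.conj_ω₁, conj_conj]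
  refine PeriodPair.mem_lattice.2 ⟨n, m, ?_⟩
  simp only [map_add, map_mul, map_intCast, h.conj_ω₁, h2]
  ring

theorem IsRhombic.weierstrassSigma_conj (h : IsRhombic L) (u : ℂ) :
    weierstrassSigma L (conj u) = conj (weierstrassSigma L u) := by
  let c : L.lattice → L.lattice := fun w => ⟨conj (w : ℂ), h.conj_mem w.2⟩
  have hc : Function.Involutive c := fun w => Subtype.ext (conj_conj _)
  have hc0 : ∀ w, c w = 0 ↔ w = 0 := fun w => by
    rw [Subtype.ext_iff, Subtype.ext_iff]
    exact map_eq_zero (starRingEnd ℂ)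
  let e : NonzeroLattice L ≃ NonzeroLattice L :=
    hc.toPerm.subtypeEquiv fun w => (not_congr (hc0 w)).symm
  rw [weierstrassSigma_eq, weierstrassSigma_eq, map_mul, sigmaProd, sigmaProd,
    (multipliable_one_add_of_summable (summable_norm_sigmaFactor u)).map_tprod
      (starRingEnd ℂ) continuous_conj, ← e.tprod_eq]
  congr 2
  ext w
  have he : ((e w : L.lattice) : ℂ) = conj ((w : L.lattice) : ℂ) := rfl
  simp only [he, sigmaFactor, map_add, map_sub, map_mul, map_one, map_div₀, map_pow, ← exp_conj,
    map_ofNat]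

theorem IsRhombic.weierstrassZeta_conj (h : IsRhombic L) (u : ℂ) :
    weierstrassZeta L (conj u) = conj (weierstrassZeta L u) := by
  have hf : conj ∘ weierstrassSigma L ∘ conj = weierstrassSigma L := by
    ext v
    simp [h.weierstrassSigma_conj]
  have hd := congrFun (deriv_conj_conj (f := weierstrassSigma L)) (conj u)
  rw [hf] at hd
  simp only [Function.comp_apply, conj_conj] at hd
  rw [weierstrassZeta, weierstrassZeta, hd, h.weierstrassSigma_conj, map_div₀]

/-- The function whose imaginary part is the negative of the second derivative of the potentials
of rhombic lattices. -/
def zetaDifference (L : PeriodPair) (θ x : ℝ) : ℂ :=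
  weierstrassZeta L (x + I * θ) - weierstrassZeta L (x - I * θ)

variable {θ : ℝ}

theorem sub_notMem_lattice (hθ : ∀ Z : ℝ, (Z : ℂ) + I * θ ∉ L.lattice) (x : ℝ) :
    (x : ℂ) - I * θ ∉ L.lattice := fun hx => hθ (-x) (by
  have := L.lattice.neg_mem hx
  rwa [neg_sub, sub_eq_neg_add, ← ofReal_neg] at this)

theorem hasDerivAt_zetaDifference (hθ : ∀ Z : ℝ, (Z : ℂ) + I * θ ∉ L.lattice) (x : ℝ) :
    HasDerivAt (zetaDifference L θ)
      (-L.weierstrassP (x + I * θ) - -L.weierstrassP (x - I * θ)) x := by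
  have h1 : HasDerivAt (fun v : ℂ => weierstrassZeta L (v + I * θ)) _ (x : ℂ) :=
    (hasDerivAt_weierstrassZeta (hθ x)).comp_add_const (x : ℂ) (I * θ)
  have h2 : HasDerivAt (fun v : ℂ => weierstrassZeta L (v - I * θ)) _ (x : ℂ) :=
    (hasDerivAt_weierstrassZeta (sub_notMem_lattice hθ x)).comp_sub_const (x : ℂ) (I * θ)
  exact (h1.sub h2).comp_ofReal

theorem zetaDifference_neg (x : ℝ) : zetaDifference L θ (-x) = zetaDifference L θ x := by
  have h1 : ((-x : ℝ) : ℂ) + I * θ = -(x - I * θ) := by push_cast; ring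
  have h2 : ((-x : ℝ) : ℂ) - I * θ = -(x + I * θ) := by push_cast; ring
  rw [zetaDifference, zetaDifference, h1, h2, weierstrassZeta_neg, weierstrassZeta_neg]
  ring

theorem IsRhombic.periodic_zetaDifference (h : IsRhombic L)
    (hθ : ∀ Z : ℝ, (Z : ℂ) + I * θ ∉ L.lattice) :
    Function.Periodic (zetaDifference L θ) (L.ω₁ + L.ω₂).re := by
  set T := (L.ω₁ + L.ω₂).re with hT
  have hT' : (T : ℂ) = L.ω₁ + L.ω₂ := by
    apply Complex.ext
    · simp [hT]
    · rw [h.sum_im, ofReal_im]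
  have hmem : (T : ℂ) ∈ L.lattice := by
    rw [hT']; exact L.lattice.add_mem L.ω₁_mem_lattice L.ω₂_mem_lattice
  have hP : ∀ v, L.weierstrassP (v + T) = L.weierstrassP v := fun v =>
    L.weierstrassP_add_coe v ⟨T, hmem⟩
  have hd : ∀ x : ℝ,
      HasDerivAt (fun x => zetaDifference L θ (x + T) - zetaDifference L θ x) 0 x := fun x => by
    have h1 := ((hasDerivAt_zetaDifference hθ (x + T)).comp_add_const x T).sub
      (hasDerivAt_zetaDifference hθ x)
    convert! h1 using 1
    have e1 : ((x + T : ℝ) : ℂ) + I * θ = x + I * θ + T := by push_cast; ring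
    have e2 : ((x + T : ℝ) : ℂ) - I * θ = x - I * θ + T := by push_cast; ring
    rw [e1, e2, hP, hP, sub_self]
  intro x
  -- The increment over `T` is constant. At `-(T / 2)` it compares the values at `T / 2` and `-(T /
  -- 2)`, which agree by evenness, so no quasi-period of `ζ` has to be computed.
  have := is_const_of_deriv_eq_zero (fun x => (hd x).differentiableAt) (fun x => (hd x).deriv)
    x (-(T / 2))
  have e : -(T / 2) + T = T / 2 := by ring
  rw [e, zetaDifference_neg, sub_self] at this
  exact sub_eq_zero.1 this

theorem IsRhombic.rhombicPotential_eq (h : IsRhombic L)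
    (hθ : ∀ Z : ℝ, (Z : ℂ) + I * θ ∉ L.lattice) (Z : ℝ) :
    rhombicPotential L θ Z = doubleIntegral (fun x => -(zetaDifference L θ x).im) Z := by
  refine logIntegral_eq (g := fun x => (zetaDifference L θ x).im) (fun x => ?_) Z
  have hda : HasDerivAt (fun u => weierstrassSigma L (u + I * θ)) _ (x : ℂ) :=
    (differentiable_weierstrassSigma.differentiableAt.hasDerivAt).comp_add_const (x : ℂ) (I * θ)
  have hdb : HasDerivAt (fun u => weierstrassSigma L (u - I * θ)) _ (x : ℂ) :=
    (differentiable_weierstrassSigma.differentiableAt.hasDerivAt).comp_sub_const (x : ℂ) (I * θ)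
  have hneg : (fun u => -(weierstrassSigma L (u + I * θ) / weierstrassSigma L (u - I * θ))) =
      fun u => -1 * (weierstrassSigma L (u + I * θ) / weierstrassSigma L (u - I * θ)) := by
    ext u; ring
  -- Since `ζ` commutes with conjugation, the difference is a number minus its conjugate, hence
  -- purely imaginary.
  have hconj : (x : ℂ) - I * θ = conj ((x : ℂ) + I * θ) := by
    simp [sub_eq_add_neg]
  rw [← logDeriv_apply, hneg, logDeriv_const_mul _ _ (neg_ne_zero.2 one_ne_zero),
    logDeriv_div (f := fun u => weierstrassSigma L (u + I * θ))
      (g := fun u => weierstrassSigma L (u - I * θ)) _ (weierstrassSigma_ne_zero (hθ x))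
      (weierstrassSigma_ne_zero (sub_notMem_lattice hθ x)) hda.differentiableAt
      hdb.differentiableAt, logDeriv_apply, logDeriv_apply, hda.deriv, hdb.deriv]
  change weierstrassZeta L (x + I * θ) - weierstrassZeta L (x - I * θ) =
    I * ((weierstrassZeta L (x + I * θ) - weierstrassZeta L (x - I * θ)).im : ℝ)
  rw [hconj, h.weierstrassZeta_conj, sub_conj]
  simp [mul_comm]

theorem dirichletUniquelySolvable_rhombic {V E : Type*} [Fintype V] [Nontrivial V] [Fintype E]
    {src tgt : E → V} (hconn : IsConnected src tgt) {θ : E → ℝ} (Θ : V → ℝ) (B : Set V)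
    (b : V → ℝ) (h : IsRhombic L) (hθ : RhombicConvexLabels L θ) :
    DirichletUniquelySolvable (action src tgt (rhombicPotential L) θ Θ) B b := by
  refine dirichletUniquelySolvable_of_periodic hconn Θ B b
    (g := fun e x => -(zetaDifference L (θ e) x).im) (T := (L.ω₁ + L.ω₂).re)
    (fun e => (continuous_im.comp (continuous_iff_continuousAt.2 fun x =>
      (hasDerivAt_zetaDifference (hθ.1 e) x).continuousAt)).neg)
    (fun e Z => h.rhombicPotential_eq (hθ.1 e) Z) h.sum_re.ne'
    (fun e x => by simp only [h.periodic_zetaDifference (hθ.1 e) x]) ?_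
  exact hθ.2.imp (fun h e Z => neg_pos.2 (h e Z)) (fun h e Z => neg_lt_zero.2 (h e Z))

end

end QuadFour

end

theorem mainTheorem2 {V E : Type*} [Fintype V] [Nontrivial V] [Fintype E]
    (src tgt : E → V) (hconn : QuadFour.IsConnected src tgt)
    (θ : E → ℝ) (Θ : V → ℝ) (B : Set V) (b : V → ℝ) :
    (∀ τ : ℂ, τ.re = 0 → 0 < τ.im → QuadFour.RectConvexLabels θ →
      QuadFour.DirichletUniquelySolvable
        (QuadFour.action src tgt (QuadFour.rectPotential τ) θ Θ) B b) ∧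
    (∀ L : PeriodPair, QuadFour.IsRhombic L → QuadFour.RhombicConvexLabels L θ →
      QuadFour.DirichletUniquelySolvable
        (QuadFour.action src tgt (QuadFour.rhombicPotential L) θ Θ) B b) := by
  exact ⟨fun _ hre him hθ => QuadFour.dirichletUniquelySolvable_rect hconn Θ B b hre him hθ,
    fun _ hL hθ => QuadFour.dirichletUniquelySolvable_rhombic hconn Θ B b hL hθ⟩
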